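/- Let $n,p\ge 1$, let $A_1,\dots,A_n\in\mathbb R^{p\times p}$ be symmetric, let $x^*\in\mathbb R^p\setminus\{0\}$, and let $b_i=\langle x^*,A_ix^*\rangle+\varepsilon_i$ for $i=1,\dots,n$. Write $\|\cdot\|$ for the Euclidean norm of vectors and the spectral norm of matrices, and put $$\varphi_i(x)=\langle x,A_ix\rangle-b_i,\qquad f(x)=\frac1{4n}\sum_{i=1}^n\varphi_i(x)^2,\qquad H(x)=\frac2n\sum_{i=1}^n (A_ix)(A_ix)^\top .$$ Assume that there are constants $\underline\lambda,\bar\lambda>0$ with $\bar\lambda<3\underline\lambda$ such that $$\underline\lambda\|u\|^2\|v\|^2\le\frac1n\sum_{i=1}^n\langle u,A_iv\rangle^2\le\bar\lambda\|u\|^2\|v\|^2\qquad\text{for all }u,v\in\mathbb R^p .$$ Assume that $\varepsilon_1,\dots,\varepsilon_n$ are i.i.d. random variables with mean zero and positive variance $\mathbb E\varepsilon_1^2$, sub-Gaussian with variance proxy $\varsigma^2>0$ (that is, $\mathbb E e^{t\varepsilon_i}\le e^{\varsigma^2t^2/2}$ for all $t\in\mathbb R$), and that $$\frac{n}{p\log(1+2n)}\ge\max\left\{\frac{98(4\underline\lambda+3\bar\lambda)^4\bar\lambda\varsigma^2}{\underline\lambda(3\underline\lambda-\bar\lambda)^2\|x^*\|^4},\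 \frac{96(4\underline\lambda+3\bar\lambda)^2\bar\lambda\varsigma^2}{\underline\lambda^4\|x^*\|^4}\right\}.$$ Let $\{x^k\}_{k\ge0}$ be the sequence generated by the gradient regularized Newton method (GRNM) from an arbitrary starting point $x^0\in\mathbb R^p$ (which may depend on the data) with parameters $\epsilon_1,\beta>0$ and $\mu_1,\mu_2,\alpha_1,\alpha_2,\delta\in(0,1)$. With $g^k=\nabla f(x^k)$ this is the following method. Phase I: as long as $\|g^l\|\ge\epsilon_1$ for all $l\le k$, set $x^{k+1}=x^k-\alpha_1^{j_k}g^k$, where $j_k$ is the smallest integer $j\ge0$ with $f(x^k-\alpha_1^{j}g^k)\le f(x^k)-\mu_1\alpha_1^{j}\|g^k\|^2$. Phase II: from the first index $k$ with $\|g^k\|<\epsilon_1$ on, set $x^{k+1}=x^k+\alpha_2^{j_k}d^k$, where $d^k=-(H(x^k)+\beta\|g^k\|^\delta I)^{-1}g^k$ and $j_k$ is the smallest integer $j\ge0$ with $f(x^k+\alpha_2^{j}d^k)\le f(x^k)+\mu_2\alpha_2^{j}\langle g^k,d^k\rangle$; if $g^k=0$ the method stops, and we put $x^{l}=x^k$ for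 all $l>k$. Let $p_1=2\exp\{-p\log(1+2n)\}$ and $p_2=2\exp\{-n\,\mathbb E\varepsilon_1^2/(512\varsigma^2)\}$. Then there is an event of probability at least $1-2p_1-p_2$ on which the following holds: if a nonzero accumulation point $\bar x$ of $\{x^k\}$ satisfies $$\Big\|\frac1n\sum_{i=1}^n\varphi_i(\bar x)A_i\Big\|<2\underline\lambda\|\bar x\|^2,$$ then the whole sequence $\{x^k\}$ converges to $\bar x$, the point $\bar x$ is a global minimizer of $f$, and $$\min\{\|\bar x-x^*\|,\|\bar x+x^*\|\}\le\frac{4}{\underline\lambda\|x^*\|}\sqrt{\frac{6\varsigma^2\bar\lambda\,p\log(1+2n)}{n}} .$$ -/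

import Mathlib

open MeasureTheory ProbabilityTheory Filter Topology
open scoped BigOperators

noncomputable section

namespace QMR

/-- The space `ℝ^p` with its Euclidean inner product and norm. -/
abbrev Vec (p : ℕ) : Type := EuclideanSpace ℝ (Fin p)

/-- The matrix-vector product `A x`. -/
def app {p : ℕ} (A : Matrix (Fin p) (Fin p) ℝ) (x : Vec p) : Vec p :=
  WithLp.toLp 2 (A.mulVec x.ofLp)

/-- The spectral norm of a matrix: its operator norm for the Euclidean norm. -/
def specNorm {p : ℕ} (A : Matrix (Fin p) (Fin p) ℝ) : ℝ :=
  ‖Matrix.toEuclideanCLM (n := Fin p) (𝕜 := ℝ) A‖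

/-- The isometry-type condition with the two positive constants `lo` and `hi`. -/
structure FrameBounds {n p : ℕ} (A : Fin n → Matrix (Fin p) (Fin p) ℝ) (lo hi : ℝ) : Prop where
  lo_pos : 0 < lo
  hi_pos : 0 < hi
  lower : ∀ u v : Vec p,
    lo * ‖u‖ ^ 2 * ‖v‖ ^ 2 ≤ (1 / (n : ℝ)) * ∑ i, (inner ℝ u (app (A i) v)) ^ 2
  upper : ∀ u v : Vec p,
    (1 / (n : ℝ)) * ∑ i, (inner ℝ u (app (A i) v)) ^ 2 ≤ hi * ‖u‖ ^ 2 * ‖v‖ ^ 2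

/-- The noise assumption: `ε 0, …, ε (n - 1)` are i.i.d., sub-Gaussian with positive variance
proxy `ς ^ 2`, have mean zero, and have positive variance. -/
structure SubGaussianNoise {Ω : Type*} [MeasurableSpace Ω] (μ : Measure Ω) {n : ℕ} [NeZero n]
    (ε : Fin n → Ω → ℝ) (ς : ℝ) : Prop where
  indep : iIndepFun ε μ
  identDistrib : ∀ i, IdentDistrib (ε i) (ε 0) μ μ
  proxy_pos : 0 < ς
  subGaussian : ∀ i, HasSubgaussianMGF (ε i) (Real.toNNReal (ς ^ 2)) μ
  mean_zero : ∫ ω, ε 0 ω ∂μ = 0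
  variance_pos : 0 < ∫ ω, (ε 0 ω) ^ 2 ∂μ

/-- The observations `b_i = ⟨x*, A_i x*⟩ + e_i`. -/
def observations {n p : ℕ} (A : Fin n → Matrix (Fin p) (Fin p) ℝ) (xs : Vec p)
    (e : Fin n → ℝ) : Fin n → ℝ :=
  fun i => inner ℝ xs (app (A i) xs) + e i

section Objective

variable {n p : ℕ} (A : Fin n → Matrix (Fin p) (Fin p) ℝ) (b : Fin n → ℝ)

/-- The residual `φ_i(x) = ⟨x, A_i x⟩ - b_i`. -/
def residual (i : Fin n) (x : Vec p) : ℝ := inner ℝ x (app (A i) x) - b i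

/-- The least squares objective. -/
def objective (x : Vec p) : ℝ := (1 / (4 * (n : ℝ))) * ∑ i, (residual A b i x) ^ 2

/-- The `n × p` matrix whose rows are `A_1 x, …, A_n x`. -/
def rowMatrix (x : Vec p) : Matrix (Fin n) (Fin p) ℝ :=
  Matrix.of fun i j => (app (A i) x) j

/-- The Gauss-Newton part `(2 / n) 𝐀(x)ᵀ 𝐀(x)` of the Hessian. -/
def gaussNewton (x : Vec p) : Matrix (Fin p) (Fin p) ℝ :=
  (2 / (n : ℝ)) • ((rowMatrix A x).transpose * rowMatrix A x)

end Objective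

/-- The parameters of the gradient regularized Newton method (GRNM). -/
structure Params where
  ε₁ : ℝ
  β : ℝ
  μ₁ : ℝ
  μ₂ : ℝ
  α₁ : ℝ
  α₂ : ℝ
  δ : ℝ
  ε₁_pos : 0 < ε₁
  β_pos : 0 < β
  μ₁_mem : μ₁ ∈ Set.Ioo (0 : ℝ) 1
  μ₂_mem : μ₂ ∈ Set.Ioo (0 : ℝ) 1
  α₁_mem : α₁ ∈ Set.Ioo (0 : ℝ) 1
  α₂_mem : α₂ ∈ Set.Ioo (0 : ℝ) 1
  δ_mem : δ ∈ Set.Ioo (0 : ℝ) 1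

section Algorithm

variable {n p : ℕ} (A : Fin n → Matrix (Fin p) (Fin p) ℝ) (b : Fin n → ℝ) (P : Params)

/-- Backtracking exponent of the first phase: the smallest `j` that passes the Armijo test.
(Some `j` passes, because the objective is differentiable and `μ₁ < 1`.) -/
def gradExponent (x : Vec p) : ℕ :=
  sInf {j : ℕ | objective A b (x - P.α₁ ^ j • gradient (objective A b) x) ≤
    objective A b x - P.μ₁ * P.α₁ ^ j * ‖gradient (objective A b) x‖ ^ 2}

/-- One gradient descent step. -/
def gradStep (x : Vec p) : Vec p :=
  x - P.α₁ ^ gradExponent A b P x • gradient (objective A b) x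

/-- The regularized Newton direction `d = -(H + β ‖g‖^δ I)⁻¹ g`. The matrix is positive definite
unless `g = 0`, and then `d = 0`. -/
def newtonDir (x : Vec p) : Vec p :=
  -app (gaussNewton A x + (P.β * ‖gradient (objective A b) x‖ ^ P.δ) •
    (1 : Matrix (Fin p) (Fin p) ℝ))⁻¹ (gradient (objective A b) x)

/-- Backtracking exponent of the second phase: the smallest `j` that passes the Armijo test.
(Some `j` passes, because `d` is a descent direction, or `g = d = 0`.) -/
def newtonExponent (x : Vec p) : ℕ :=
  sInf {j : ℕ | objective A b (x + P.α₂ ^ j • newtonDir A b P x) ≤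
    objective A b x +
      P.μ₂ * P.α₂ ^ j * inner ℝ (gradient (objective A b) x) (newtonDir A b P x)}

/-- One regularized Newton step. It leaves `x` unchanged when the gradient vanishes at `x`, so a
run that stops at a stationary point is continued by a constant sequence. -/
def newtonStep (x : Vec p) : Vec p :=
  x + P.α₂ ^ newtonExponent A b P x • newtonDir A b P x

open Classical in
/-- The state after `k` iterations: the iterate `x^k`, and whether the second phase has been
entered, that is, whether `‖g^l‖ < ε₁` for some `l ≤ k`. -/
def grnmState (x₀ : Vec p) : ℕ → Vec p × Prop
  | 0 => (x₀, ‖gradient (objective A b) x₀‖ < P.ε₁)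
  | k + 1 =>
    let s := grnmState x₀ k
    let x' := if s.2 then newtonStep A b P s.1 else gradStep A b P s.1
    (x', s.2 ∨ ‖gradient (objective A b) x'‖ < P.ε₁)

/-- The sequence `x^0, x^1, …` generated by GRNM from `x^0 = x₀`. -/
def grnm (x₀ : Vec p) (k : ℕ) : Vec p := (grnmState A b P x₀ k).1

end Algorithm

/-- `p₁ = 2 exp (-p log (1 + 2n))`. -/
def prob₁ (n p : ℕ) : ℝ := 2 * Real.exp (-((p : ℝ) * Real.log (1 + 2 * (n : ℝ))))

/-- `p₂ = 2 exp (-n v / (512 ς²))`, where `v` is the variance of the noise. -/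
def prob₂ (n : ℕ) (v ς : ℝ) : ℝ := 2 * Real.exp (-((n : ℝ) * v / (512 * ς ^ 2)))

end QMR

end

/-!
Write `S(x) = (1 / n) ∑ i, φ_i(x) A_i` (`residualMean`) and let `N` be the spectral norm of the
noise matrix `(1 / n) ∑ i, ε_i A_i`. The objective is a quartic with the exact expansion
`f(x + h) = f(x) + ⟨S(x) x, h⟩ + (1 / 4n) ∑ i, ⟨h, A_i (2 x + h)⟩² + (1 / 2) ⟨h, S(x) h⟩`
(`objective_add`), in which the frame bounds control the mean of squares. Everything deterministic
comes from this formula: the gradient `S(x) x`, the quadratic upper model that the line searches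
need, and lower bounds at stationary points.

*Convergence.* Near a nonzero point the steps of both phases are uniformly gradient related,
because the Gauss-Newton matrix is bounded below by `2 lo ‖x‖²`. Hence each step from there
decreases `f` by a multiple of `‖∇f‖²` and has length at most a multiple of `‖∇f‖`
(`exists_eventually_step`), and `f` never increases along the run. So a nonzero accumulation point
is stationary. If moreover `‖S(x)‖ < 2 lo ‖x‖²` there, then `f` grows quadratically around it, and
the sequence cannot leave its neighbourhood (`tendsto_grnm`).

*Error bound.* At such a point `x` the symmetric matrix `S(x)` annihilates `x`, so
`⟨x*, S(x) x*⟩` is bounded below by `-2 lo ‖x‖² ‖w‖²`, where `w` is the component of `x*`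
orthogonal to `x`. Comparing with the lower frame bound for the pair `x - x*`, `x + x*` yields
`lo ‖x - x*‖ ‖x + x*‖ ≤ 2 N` (`mul_norm_sub_mul_norm_add_le`). The larger of the two distances is at
least `‖x*‖`, which bounds the smaller one.

*Global minimality.* The same product bounds `‖S(x)‖`, so for small `N` one has
`‖S(x)‖ ≤ (lo / 2) ‖x‖²`; with the expansion at `x` and `f(y) = f(-y)` this gives `f(x) ≤ f(y)` for
every `y` (`objective_le_of_stationary`).

*Noise.* The norm of a symmetric matrix is at most twice the maximum of its quadratic form over a
`1/4`-net of the sphere, which has at most `9 ^ p` points. A sub-Gaussian tail bound at each point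
and the union bound give `N ≤ 2 √(6 ς² hi p log (1 + 2 n) / n)` outside an event of probability
`prob₁ n p` (`measureReal_specNorm_noise_gt_le`). The sample size condition turns this into the
smallness of `N` used above.
-/

namespace QMR

/-! ### Matrices acting on Euclidean space -/

section Matrices

variable {p : ℕ}

theorem app_eq_toEuclideanCLM (M : Matrix (Fin p) (Fin p) ℝ) (x : Vec p) :
    app M x = Matrix.toEuclideanCLM (n := Fin p) (𝕜 := ℝ) M x := rfl

theorem app_add (M : Matrix (Fin p) (Fin p) ℝ) (x y : Vec p) :
    app M (x + y) = app M x + app M y := by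
  simp only [app_eq_toEuclideanCLM, map_add]

theorem app_sub (M : Matrix (Fin p) (Fin p) ℝ) (x y : Vec p) :
    app M (x - y) = app M x - app M y := by
  simp only [app_eq_toEuclideanCLM, map_sub]

theorem app_smul (M : Matrix (Fin p) (Fin p) ℝ) (c : ℝ) (x : Vec p) :
    app M (c • x) = c • app M x := by
  simp only [app_eq_toEuclideanCLM, map_smul]

theorem app_neg (M : Matrix (Fin p) (Fin p) ℝ) (x : Vec p) : app M (-x) = -app M x := by
  simp only [app_eq_toEuclideanCLM, map_neg]

theorem app_zero (M : Matrix (Fin p) (Fin p) ℝ) : app M (0 : Vec p) = 0 := by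
  simp only [app_eq_toEuclideanCLM, map_zero]

theorem app_mul (M N : Matrix (Fin p) (Fin p) ℝ) (x : Vec p) :
    app (M * N) x = app M (app N x) := by
  simp only [app_eq_toEuclideanCLM, map_mul]; rfl

theorem app_one (x : Vec p) : app (1 : Matrix (Fin p) (Fin p) ℝ) x = x := by
  simp only [app_eq_toEuclideanCLM, map_one]; rfl

theorem add_app (M N : Matrix (Fin p) (Fin p) ℝ) (x : Vec p) :
    app (M + N) x = app M x + app N x := by
  simp only [app_eq_toEuclideanCLM, map_add]; rfl

theorem smul_app (c : ℝ) (M : Matrix (Fin p) (Fin p) ℝ) (x : Vec p) :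
    app (c • M) x = c • app M x := by
  simp only [app_eq_toEuclideanCLM, map_smul]; rfl

@[fun_prop]
theorem continuous_app (M : Matrix (Fin p) (Fin p) ℝ) : Continuous (app M) :=
  (Matrix.toEuclideanCLM (n := Fin p) (𝕜 := ℝ) M).continuous

theorem inner_app_eq_dotProduct (M : Matrix (Fin p) (Fin p) ℝ) (x y : Vec p) :
    inner ℝ x (app M y) = x.ofLp ⬝ᵥ M.mulVec y.ofLp :=
  Matrix.inner_toEuclideanCLM M x y

theorem inner_app_comm {M : Matrix (Fin p) (Fin p) ℝ} (hM : M.IsSymm) (x y : Vec p) :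
    inner ℝ x (app M y) = inner ℝ y (app M x) := by
  rw [inner_app_eq_dotProduct, inner_app_eq_dotProduct, Matrix.dotProduct_mulVec,
    ← Matrix.mulVec_transpose, hM.eq, dotProduct_comm]

theorem specNorm_nonneg (M : Matrix (Fin p) (Fin p) ℝ) : 0 ≤ specNorm M := norm_nonneg _

theorem norm_app_le (M : Matrix (Fin p) (Fin p) ℝ) (x : Vec p) :
    ‖app M x‖ ≤ specNorm M * ‖x‖ :=
  (Matrix.toEuclideanCLM (n := Fin p) (𝕜 := ℝ) M).le_opNorm x

theorem abs_inner_app_le (M : Matrix (Fin p) (Fin p) ℝ) (u v : Vec p) :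
    |inner ℝ u (app M v)| ≤ specNorm M * ‖u‖ * ‖v‖ := by
  calc |inner ℝ u (app M v)| ≤ ‖u‖ * ‖app M v‖ := abs_real_inner_le_norm _ _
    _ ≤ ‖u‖ * (specNorm M * ‖v‖) := by gcongr; exact norm_app_le M v
    _ = specNorm M * ‖u‖ * ‖v‖ := by ring

theorem specNorm_le_of_abs_inner_le {M : Matrix (Fin p) (Fin p) ℝ} {C : ℝ} (hC : 0 ≤ C)
    (h : ∀ u v : Vec p, |inner ℝ u (app M v)| ≤ C * ‖u‖ * ‖v‖) : specNorm M ≤ C := by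
  refine ContinuousLinearMap.opNorm_le_bound _ hC fun v => ?_
  change ‖app M v‖ ≤ C * ‖v‖
  by_cases h0 : ‖app M v‖ = 0
  · rw [h0]; positivity
  have h1 := h (app M v) v
  rw [real_inner_self_eq_norm_sq, abs_of_nonneg (by positivity)] at h1
  have : 0 < ‖app M v‖ := lt_of_le_of_ne (norm_nonneg _) (Ne.symm h0)
  nlinarith

end Matrices

/-! ### Weighted means of the sensing matrices and the frame bounds -/

section Means

variable {n p : ℕ}

/-- The weighted mean `(1 / n) ∑ i, c i A_i`. With the residuals at `x` as weights it is the part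
of the Hessian that the Gauss-Newton matrix leaves out; with the noise as weights it measures the
effect of the noise. -/
noncomputable def weightedMean (A : Fin n → Matrix (Fin p) (Fin p) ℝ) (c : Fin n → ℝ) :
    Matrix (Fin p) (Fin p) ℝ :=
  (1 / (n : ℝ)) • ∑ i, c i • A i

theorem weightedMean_app (A : Fin n → Matrix (Fin p) (Fin p) ℝ) (c : Fin n → ℝ) (v : Vec p) :
    app (weightedMean A c) v = (1 / (n : ℝ)) • ∑ i, c i • app (A i) v := by
  simp only [weightedMean, app_eq_toEuclideanCLM, map_smul, map_sum,
    smul_apply, sum_apply]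

theorem inner_weightedMean (A : Fin n → Matrix (Fin p) (Fin p) ℝ) (c : Fin n → ℝ)
    (u v : Vec p) :
    inner ℝ u (app (weightedMean A c) v) =
      (1 / (n : ℝ)) * ∑ i, c i * inner ℝ u (app (A i) v) := by
  rw [weightedMean_app, inner_smul_right, inner_sum]
  simp only [inner_smul_right]

theorem isSymm_weightedMean {A : Fin n → Matrix (Fin p) (Fin p) ℝ} (hA : ∀ i, (A i).IsSymm)
    (c : Fin n → ℝ) : (weightedMean A c).IsSymm := by
  refine Matrix.IsSymm.smul ?_ _
  simp only [Matrix.IsSymm, Matrix.transpose_sum, Matrix.transpose_smul, (hA _).eq]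

theorem continuous_specNorm_weightedMean {X : Type*} [TopologicalSpace X]
    (A : Fin n → Matrix (Fin p) (Fin p) ℝ) {c : Fin n → X → ℝ} (hc : ∀ i, Continuous (c i)) :
    Continuous fun x => specNorm (weightedMean A fun i => c i x) := by
  simp only [specNorm, weightedMean, map_smul, map_sum]
  fun_prop

/-- The polarized form of the upper frame bound, by the Cauchy-Schwarz inequality. -/
theorem FrameBounds.mean_mul_le {A : Fin n → Matrix (Fin p) (Fin p) ℝ} {lo hi : ℝ}
    (hA : FrameBounds A lo hi) (u v y z : Vec p) :
    |(1 / (n : ℝ)) * ∑ i, inner ℝ u (app (A i) v) * inner ℝ y (app (A i) z)| ≤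
      hi * (‖u‖ * ‖v‖) * (‖y‖ * ‖z‖) := by
  have h1 := hA.upper u v
  have h2 := hA.upper y z
  have hhi := hA.hi_pos
  have hcs := Finset.sum_mul_sq_le_sq_mul_sq Finset.univ
    (fun i => inner ℝ u (app (A i) v)) (fun i => inner ℝ y (app (A i) z))
  refine abs_le_of_sq_le_sq ?_ (by positivity)
  calc ((1 / (n : ℝ)) * ∑ i, inner ℝ u (app (A i) v) * inner ℝ y (app (A i) z)) ^ 2
      = (1 / (n : ℝ)) ^ 2 *
          (∑ i, inner ℝ u (app (A i) v) * inner ℝ y (app (A i) z)) ^ 2 := by ring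
    _ ≤ (1 / (n : ℝ)) ^ 2 * ((∑ i, (inner ℝ u (app (A i) v)) ^ 2) *
          ∑ i, (inner ℝ y (app (A i) z)) ^ 2) := by gcongr
    _ = ((1 / (n : ℝ)) * ∑ i, (inner ℝ u (app (A i) v)) ^ 2) *
          ((1 / (n : ℝ)) * ∑ i, (inner ℝ y (app (A i) z)) ^ 2) := by ring
    _ ≤ (hi * ‖u‖ ^ 2 * ‖v‖ ^ 2) * (hi * ‖y‖ ^ 2 * ‖z‖ ^ 2) :=
        mul_le_mul h1 h2 (mul_nonneg (by positivity)
          (Finset.sum_nonneg fun i _ => sq_nonneg _)) (by positivity)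
    _ = (hi * (‖u‖ * ‖v‖) * (‖y‖ * ‖z‖)) ^ 2 := by ring

end Means

/-! ### The objective, its gradient and its local behaviour -/

section Objective

variable {n p : ℕ} (A : Fin n → Matrix (Fin p) (Fin p) ℝ) (b : Fin n → ℝ)

@[fun_prop]
theorem continuous_residual (i : Fin n) : Continuous (residual A b i) := by
  unfold residual; fun_prop

@[fun_prop]
theorem continuous_objective : Continuous (objective A b) := by
  unfold objective; fun_prop

theorem objective_neg (x : Vec p) : objective A b (-x) = objective A b x := by
  simp only [objective, residual, app_neg, inner_neg_neg]

/-- The matrix `(1 / n) ∑ i, φ_i(x) A_i`, which is the Hessian of the objective at `x` without its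
Gauss-Newton part. -/
noncomputable def residualMean (x : Vec p) : Matrix (Fin p) (Fin p) ℝ :=
  weightedMean A fun i => residual A b i x

theorem continuous_specNorm_residualMean : Continuous fun x => specNorm (residualMean A b x) :=
  continuous_specNorm_weightedMean A fun i => continuous_residual A b i

variable {A}

theorem residual_add (hA : ∀ i, (A i).IsSymm) (i : Fin n) (x h : Vec p) :
    residual A b i (x + h) = residual A b i x +
      (2 * inner ℝ h (app (A i) x) + inner ℝ h (app (A i) h)) := by
  simp only [residual, app_add, inner_add_left, inner_add_right, inner_app_comm (hA i) x h]
  ring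

/-- The exact expansion of the quartic objective. The terms of order two to four group into a mean
of squares, to which the frame bounds apply, and a quadratic form. -/
theorem objective_add [NeZero n] (hA : ∀ i, (A i).IsSymm) (x h : Vec p) :
    objective A b (x + h) = objective A b x + inner ℝ (app (residualMean A b x) x) h +
      (1 / 4) * ((1 / (n : ℝ)) * ∑ i, (inner ℝ h (app (A i) ((2 : ℝ) • x + h))) ^ 2) +
      (1 / 2) * inner ℝ h (app (residualMean A b x) h) := by
  have hn : (n : ℝ) ≠ 0 := Nat.cast_ne_zero.2 (NeZero.ne n)
  rw [real_inner_comm]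
  simp only [residualMean, inner_weightedMean, objective, residual_add b hA, Finset.mul_sum,
    ← Finset.sum_add_distrib]
  refine Finset.sum_congr rfl fun i _ => ?_
  simp only [app_add, app_smul, inner_add_right, inner_smul_right]
  field_simp
  ring

theorem abs_objective_add_sub_le [NeZero n] (hA : ∀ i, (A i).IsSymm) {lo hi : ℝ}
    (hF : FrameBounds A lo hi) (x h : Vec p) :
    |objective A b (x + h) - objective A b x - inner ℝ (app (residualMean A b x) x) h| ≤
      (hi * (2 * ‖x‖ + ‖h‖) ^ 2 + specNorm (residualMean A b x)) * ‖h‖ ^ 2 := by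
  have h1 := hF.upper h ((2 : ℝ) • x + h)
  have h2 := abs_inner_app_le (residualMean A b x) h h
  have h3 : ‖(2 : ℝ) • x + h‖ ≤ 2 * ‖x‖ + ‖h‖ := by
    refine (norm_add_le _ _).trans ?_
    rw [norm_smul]; norm_num
  have h4 : hi * ‖h‖ ^ 2 * ‖(2 : ℝ) • x + h‖ ^ 2 ≤ hi * ‖h‖ ^ 2 * (2 * ‖x‖ + ‖h‖) ^ 2 := by
    have := hF.hi_pos
    gcongr
  have h5 : 0 ≤ (1 / (n : ℝ)) * ∑ i, (inner ℝ h (app (A i) ((2 : ℝ) • x + h))) ^ 2 :=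
    mul_nonneg (by positivity) (Finset.sum_nonneg fun i _ => sq_nonneg _)
  have h6 : 0 ≤ specNorm (residualMean A b x) * ‖h‖ ^ 2 :=
    mul_nonneg (specNorm_nonneg _) (sq_nonneg _)
  rw [objective_add b hA]
  rw [abs_le] at h2 ⊢
  constructor <;> nlinarith

theorem hasGradientAt_objective [NeZero n] (hA : ∀ i, (A i).IsSymm) {lo hi : ℝ}
    (hF : FrameBounds A lo hi) (x : Vec p) :
    HasGradientAt (objective A b) (app (residualMean A b x) x) x := by
  rw [hasGradientAt_iff_isLittleO_nhds_zero]
  have hO : (fun h : Vec p => objective A b (x + h) - objective A b x -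
      inner ℝ (app (residualMean A b x) x) h) =O[𝓝 0] fun h => ‖h‖ ^ 2 := by
    refine Asymptotics.IsBigO.of_bound
      (hi * (2 * ‖x‖ + 1) ^ 2 + specNorm (residualMean A b x)) ?_
    filter_upwards [Metric.ball_mem_nhds (0 : Vec p) one_pos] with h hh
    have hh1 : ‖h‖ ≤ 1 := by simpa using (mem_ball_zero_iff.1 hh).le
    have := hF.hi_pos
    rw [Real.norm_eq_abs, Real.norm_eq_abs, abs_of_nonneg (sq_nonneg ‖h‖)]
    refine (abs_objective_add_sub_le b hA hF x h).trans ?_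
    gcongr
  refine hO.trans_isLittleO ?_
  exact (Asymptotics.isLittleO_norm_pow_id one_lt_two)

theorem gradient_objective [NeZero n] (hA : ∀ i, (A i).IsSymm) {lo hi : ℝ}
    (hF : FrameBounds A lo hi) (x : Vec p) :
    gradient (objective A b) x = app (residualMean A b x) x :=
  (hasGradientAt_objective b hA hF x).gradient

theorem continuous_gradient_objective [NeZero n] (hA : ∀ i, (A i).IsSymm) {lo hi : ℝ}
    (hF : FrameBounds A lo hi) : Continuous (gradient (objective A b)) := by
  simp only [funext (gradient_objective b hA hF), residualMean, weightedMean_app]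
  fun_prop

/-- A lower bound for the increase of the objective from a stationary point. -/
theorem objective_lower_of_stationary [NeZero n] (hA : ∀ i, (A i).IsSymm) {lo hi : ℝ}
    (hF : FrameBounds A lo hi) {x : Vec p} (hx : app (residualMean A b x) x = 0) (y : Vec p) :
    objective A b x +
      (lo / 4 * ‖y + x‖ ^ 2 - specNorm (residualMean A b x) / 2) * ‖y - x‖ ^ 2 ≤
        objective A b y := by
  have h1 := hF.lower (y - x) ((2 : ℝ) • x + (y - x))
  have h2 := (abs_le.1 (abs_inner_app_le (residualMean A b x) (y - x) (y - x))).1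
  have h3 := objective_add b hA x (y - x)
  have e1 : x + (y - x) = y := by abel
  have e2 : (2 : ℝ) • x + (y - x) = y + x := by rw [two_smul]; abel
  rw [e1, hx, inner_zero_left, e2] at h3
  rw [e2] at h1
  rw [h3]
  nlinarith

/-- Quadratic growth at a stationary point where the residual part of the Hessian is dominated by
the Gauss-Newton part. -/
theorem eventually_quadratic_growth [NeZero n] (hA : ∀ i, (A i).IsSymm) {lo hi : ℝ}
    (hF : FrameBounds A lo hi) {x : Vec p} (hx : app (residualMean A b x) x = 0)
    (hS : specNorm (residualMean A b x) < 2 * lo * ‖x‖ ^ 2) :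
    ∃ q > 0, ∀ᶠ y in 𝓝 x, objective A b x + q * ‖y - x‖ ^ 2 ≤ objective A b y := by
  set s := specNorm (residualMean A b x)
  have hlim : Tendsto (fun y : Vec p => lo / 4 * ‖y + x‖ ^ 2 - s / 2) (𝓝 x)
      (𝓝 (lo / 4 * ‖x + x‖ ^ 2 - s / 2)) := by
    apply Continuous.tendsto
    fun_prop
  have hval : ‖x + x‖ = 2 * ‖x‖ := by rw [← two_smul ℝ x, norm_smul]; norm_num
  refine ⟨(2 * lo * ‖x‖ ^ 2 - s) / 4, by linarith, ?_⟩
  filter_upwards [hlim.eventually (lt_mem_nhds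
    (show (2 * lo * ‖x‖ ^ 2 - s) / 4 < lo / 4 * ‖x + x‖ ^ 2 - s / 2 by
      rw [hval]; nlinarith))] with y hy
  refine le_trans ?_ (objective_lower_of_stationary b hA hF hx y)
  gcongr

end Objective

/-! ### Backtracking line search and descent sequences -/

/-- Armijo backtracking along a ray. If the second order term of the model `φ0 + t a + K t²` is
controlled by the descent rate `-a`, the test passes as soon as `α ^ j ≤ (1 - μ) / B`; hence the
first step that passes is at least `min 1 (α (1 - μ) / B)`. -/
theorem armijo_backtracking {φ : ℝ → ℝ} {φ0 a K B α μ : ℝ} (hα : α ∈ Set.Ioo (0 : ℝ) 1)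
    (hμ : μ ∈ Set.Ioo (0 : ℝ) 1) (ha : a ≤ 0) (hB : 0 < B) (hK : K ≤ B * -a)
    (hφ : ∀ t, 0 < t → t ≤ 1 → φ t ≤ φ0 + t * a + K * t ^ 2) :
    φ (α ^ sInf {j : ℕ | φ (α ^ j) ≤ φ0 + μ * α ^ j * a}) ≤
        φ0 + μ * α ^ sInf {j : ℕ | φ (α ^ j) ≤ φ0 + μ * α ^ j * a} * a ∧
      min 1 (α * (1 - μ) / B) ≤ α ^ sInf {j : ℕ | φ (α ^ j) ≤ φ0 + μ * α ^ j * a} := by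
  set s := {j : ℕ | φ (α ^ j) ≤ φ0 + μ * α ^ j * a}
  have hpass : ∀ j : ℕ, α ^ j ≤ (1 - μ) / B → j ∈ s := by
    intro j hj
    have hp : 0 < α ^ j := pow_pos hα.1 j
    have h1 := hφ (α ^ j) hp (pow_le_one₀ hα.1.le hα.2.le)
    have h2 : α ^ j * B ≤ 1 - μ := (le_div_iff₀ hB).1 hj
    change φ (α ^ j) ≤ φ0 + μ * α ^ j * a
    have h3 : K * (α ^ j) ^ 2 ≤ B * -a * (α ^ j) ^ 2 := by gcongr
    have h4 : α ^ j * B * (α ^ j * -a) ≤ (1 - μ) * (α ^ j * -a) :=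
      mul_le_mul_of_nonneg_right h2 (mul_nonneg hp.le (by linarith))
    nlinarith
  have hne : s.Nonempty := by
    obtain ⟨j, hj⟩ := exists_pow_lt_of_lt_one
      (div_pos (sub_pos.2 hμ.2) hB) hα.2
    exact ⟨j, hpass j hj.le⟩
  refine ⟨Nat.sInf_mem hne, ?_⟩
  rcases Nat.eq_zero_or_pos (sInf s) with h0 | h0
  · rw [h0, pow_zero]; exact min_le_left _ _
  · have h1 : sInf s - 1 ∉ s := Nat.notMem_of_lt_sInf (Nat.sub_lt h0 one_pos)
    have h2 : (1 - μ) / B < α ^ (sInf s - 1) := by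
      by_contra hcon
      exact h1 (hpass _ (not_lt.1 hcon))
    refine (min_le_right _ _).trans ?_
    calc α * (1 - μ) / B = α * ((1 - μ) / B) := by ring
      _ ≤ α * α ^ (sInf s - 1) := mul_le_mul_of_nonneg_left h2.le hα.1.le
      _ = α ^ sInf s := by rw [← pow_succ', Nat.sub_add_cancel h0]

section DescentSequences

variable {X : Type*} [PseudoMetricSpace X] {f : X → ℝ} {x : ℕ → X} {z : X}

theorem tendsto_comp_of_antitone_of_mapClusterPt (hf : Continuous f)
    (hanti : Antitone (f ∘ x)) (hz : MapClusterPt z atTop x) :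
    Tendsto (f ∘ x) atTop (𝓝 (f z)) := by
  have hc : MapClusterPt (f z) atTop (f ∘ x) := hz.continuousAt_comp hf.continuousAt
  rcases tendsto_atTop_of_antitone hanti with h | ⟨l, hl⟩
  · obtain ⟨N, hN⟩ := (h.eventually (eventually_lt_atBot (f z - 1))).exists_forall_of_atTop
    obtain ⟨k, hk, hk2⟩ :=
      (hc.frequently (lt_mem_nhds (sub_one_lt (f z)))).forall_exists_of_atTop N
    exact absurd (hN k hk) (not_lt.2 (le_of_lt hk2))
  · have hne : (𝓝 (f z) ⊓ 𝓝 l).NeBot := hc.clusterPt.mono hl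
    rwa [eq_of_nhds_neBot hne]

/-- If every step taken near an accumulation point `z` decreases the objective by a multiple of
`G²`, then `G z = 0`. -/
theorem eq_zero_of_mapClusterPt_of_decrease {G : X → ℝ} (hf : Continuous f) (hG : Continuous G)
    (hanti : Antitone (f ∘ x)) (hz : MapClusterPt z atTop x) {c : ℝ} (hc : 0 < c)
    (hstep : ∀ᶠ y in 𝓝 z, ∀ k, x k = y → f (x (k + 1)) ≤ f (x k) - c * G (x k) ^ 2) :
    G z = 0 := by
  have hlim := tendsto_comp_of_antitone_of_mapClusterPt hf hanti hz
  by_contra hne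
  have hpos : 0 < G z ^ 2 := by positivity
  have hnear : ∀ᶠ y in 𝓝 z, G z ^ 2 / 2 < G y ^ 2 :=
    ((hG.pow 2).tendsto z).eventually (lt_mem_nhds (half_lt_self hpos))
  have hev : ∀ᶠ k in atTop, f (x k) < f z + c * (G z ^ 2 / 2) :=
    hlim.eventually (gt_mem_nhds (lt_add_of_pos_right _ (by positivity)))
  obtain ⟨k, ⟨h1, h2⟩, h3⟩ := ((hz.frequently (hstep.and hnear)).and_eventually hev).exists
  have h4 := h1 k rfl
  have h5 : f z ≤ f (x (k + 1)) := hanti.le_of_tendsto hlim (k + 1)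
  have h6 : c * (G z ^ 2 / 2) < c * G (x k) ^ 2 := by gcongr
  linarith

/-- An accumulation point with quadratic growth of the objective traps a descent sequence whose
steps near it are small: the sublevel sets near `z` shrink to `z`, and no step can jump out of the
neighbourhood in which they are controlled. -/
theorem tendsto_of_mapClusterPt_of_quadratic_growth {G : X → ℝ} (hf : Continuous f)
    (hG : Continuous G) (hGz : G z = 0) (hanti : Antitone (f ∘ x))
    (hz : MapClusterPt z atTop x) {C q : ℝ} (hq : 0 < q)
    (hstep : ∀ᶠ y in 𝓝 z, ∀ k, x k = y → dist (x (k + 1)) (x k) ≤ C * G (x k))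
    (hgrow : ∀ᶠ y in 𝓝 z, f z + q * dist y z ^ 2 ≤ f y) :
    Tendsto x atTop (𝓝 z) := by
  have hlim := tendsto_comp_of_antitone_of_mapClusterPt hf hanti hz
  obtain ⟨r, hr, hball⟩ := Metric.eventually_nhds_iff.1 (hstep.and hgrow)
  have hsmall : ∀ᶠ y in 𝓝 z, C * G y < r / 2 := by
    have : Tendsto (fun y => C * G y) (𝓝 z) (𝓝 (C * G z)) :=
      (continuous_const.mul hG).tendsto z
    exact this.eventually (gt_mem_nhds (by rw [hGz, mul_zero]; positivity))
  obtain ⟨r', hr', hball'⟩ := Metric.eventually_nhds_iff.1 hsmall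
  set ρ := min (r / 2) r'
  have hρ : 0 < ρ := lt_min (half_pos hr) hr'
  have hρr : ρ < r := (min_le_left _ _).trans_lt (half_lt_self hr)
  have hev : ∀ᶠ k in atTop, f (x k) < f z + q * ρ ^ 2 :=
    hlim.eventually (gt_mem_nhds (lt_add_of_pos_right _ (by positivity)))
  obtain ⟨K, hK⟩ := hev.exists_forall_of_atTop
  obtain ⟨k₀, hk₀, hx₀⟩ :=
    (hz.frequently (Metric.ball_mem_nhds z hρ)).forall_exists_of_atTop K
  have htrap : ∀ k, k₀ ≤ k → dist (x k) z < ρ := by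
    intro k hk
    induction k, hk using Nat.le_induction with
    | base => exact hx₀
    | succ k hk ih =>
      have h1 := (hball (ih.trans hρr)).1 k rfl
      have h2 := hball' (ih.trans_le (min_le_right _ _))
      have h3 : dist (x (k + 1)) z < r := by
        have h4 := dist_triangle (x (k + 1)) (x k) z
        have h5 : ρ ≤ r / 2 := min_le_left _ _
        linarith
      have h4 := (hball h3).2
      have h5 := hK (k + 1) (by omega)
      have h6 : dist (x (k + 1)) z ^ 2 < ρ ^ 2 := by
        have : q * dist (x (k + 1)) z ^ 2 < q * ρ ^ 2 := by linarith
        exact lt_of_mul_lt_mul_left this hq.le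
      exact lt_of_pow_lt_pow_left₀ 2 hρ.le h6
  have hsq : Tendsto (fun k => dist (x k) z ^ 2) atTop (𝓝 0) := by
    have hup : Tendsto (fun k => (f (x k) - f z) / q) atTop (𝓝 0) := by
      have := (hlim.sub_const (f z)).div_const q
      simpa using this
    refine squeeze_zero' (Eventually.of_forall fun k => sq_nonneg _) ?_ hup
    filter_upwards [eventually_ge_atTop k₀] with k hk
    rw [le_div_iff₀ hq]
    have := (hball ((htrap k hk).trans hρr)).2
    linarith
  rw [tendsto_iff_dist_tendsto_zero]
  have := hsq.sqrt
  simpa [Real.sqrt_sq dist_nonneg] using this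

end DescentSequences

/-! ### Gradient regularized Newton steps -/

section Newton

variable {n p : ℕ} {A : Fin n → Matrix (Fin p) (Fin p) ℝ} (b : Fin n → ℝ) (P : Params)

theorem inner_gaussNewton (x u v : Vec p) :
    inner ℝ u (app (gaussNewton A x) v) =
      2 * ((1 / (n : ℝ)) * ∑ i, inner ℝ u (app (A i) x) * inner ℝ v (app (A i) x)) := by
  have key : ∀ w : Vec p, ∀ i, inner ℝ w (app (A i) x) = (rowMatrix A x).mulVec w.ofLp i := by
    intro w i
    rw [inner_app_eq_dotProduct, dotProduct_comm]
    rfl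
  rw [inner_app_eq_dotProduct, gaussNewton, Matrix.smul_mulVec, dotProduct_smul,
    ← Matrix.mulVec_mulVec, Matrix.dotProduct_mulVec, ← Matrix.mulVec_transpose,
    Matrix.transpose_transpose]
  simp only [key, dotProduct, smul_eq_mul]
  ring

/-- The matrix `H(x) + β ‖∇f(x)‖^δ I` of the Newton system. -/
noncomputable def regMatrix (A : Fin n → Matrix (Fin p) (Fin p) ℝ) (b : Fin n → ℝ) (P : Params)
    (x : Vec p) : Matrix (Fin p) (Fin p) ℝ :=
  gaussNewton A x + (P.β * ‖gradient (objective A b) x‖ ^ P.δ) • (1 : Matrix (Fin p) (Fin p) ℝ)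

variable {b P}

theorem inner_regMatrix (x u v : Vec p) :
    inner ℝ u (app (regMatrix A b P x) v) =
      2 * ((1 / (n : ℝ)) * ∑ i, inner ℝ u (app (A i) x) * inner ℝ v (app (A i) x)) +
        P.β * ‖gradient (objective A b) x‖ ^ P.δ * inner ℝ u v := by
  rw [regMatrix, add_app, inner_add_right, inner_gaussNewton, smul_app, app_one,
    inner_smul_right]

theorem regularization_nonneg (x : Vec p) : 0 ≤ P.β * ‖gradient (objective A b) x‖ ^ P.δ :=
  mul_nonneg P.β_pos.le (Real.rpow_nonneg (norm_nonneg _) _)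

theorem inner_regMatrix_self_ge {lo hi : ℝ} (hF : FrameBounds A lo hi) (x v : Vec p) :
    (2 * lo * ‖x‖ ^ 2 + P.β * ‖gradient (objective A b) x‖ ^ P.δ) * ‖v‖ ^ 2 ≤
      inner ℝ v (app (regMatrix A b P x) v) := by
  have h := hF.lower v x
  rw [inner_regMatrix, real_inner_self_eq_norm_sq]
  simp only [← pow_two]
  linarith

theorem norm_regMatrix_app_le {lo hi : ℝ} (hF : FrameBounds A lo hi) (x v : Vec p) :
    ‖app (regMatrix A b P x) v‖ ≤
      (2 * hi * ‖x‖ ^ 2 + P.β * ‖gradient (objective A b) x‖ ^ P.δ) * ‖v‖ := by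
  refine (norm_app_le _ _).trans ?_
  gcongr
  have h0 := regularization_nonneg (A := A) (b := b) (P := P) x
  have hhi := hF.hi_pos
  refine specNorm_le_of_abs_inner_le (by positivity) fun u w => ?_
  rw [inner_regMatrix]
  have h1 := abs_le.1 (hF.mean_mul_le u x w x)
  have h2 := abs_le.1 (abs_real_inner_le_norm u w)
  have h3 := mul_le_mul_of_nonneg_left h2.1 h0
  have h4 := mul_le_mul_of_nonneg_left h2.2 h0
  rw [abs_le]
  constructor <;> nlinarith

theorem regMatrix_app_newtonDir {lo hi : ℝ} (hF : FrameBounds A lo hi) (x : Vec p) :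
    app (regMatrix A b P x) (newtonDir A b P x) = -gradient (objective A b) x := by
  by_cases hg : gradient (objective A b) x = 0
  · simp only [newtonDir, hg, app_zero, neg_zero]
  have hpos : 0 < P.β * ‖gradient (objective A b) x‖ ^ P.δ :=
    mul_pos P.β_pos (Real.rpow_pos_of_pos (norm_pos_iff.2 hg) _)
  have hlo := hF.lo_pos
  have hunit : IsUnit (regMatrix A b P x) := by
    rw [← Matrix.mulVec_injective_iff_isUnit]
    intro v w hvw
    have h1 : app (regMatrix A b P x) (WithLp.toLp 2 v - WithLp.toLp 2 w) = 0 := by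
      rw [app_sub, sub_eq_zero]
      exact congrArg (WithLp.toLp 2) hvw
    have h2 := inner_regMatrix_self_ge (b := b) (P := P) hF x (WithLp.toLp 2 v - WithLp.toLp 2 w)
    rw [h1, inner_zero_right] at h2
    have h3 : ‖(WithLp.toLp 2 v - WithLp.toLp 2 w : Vec p)‖ ^ 2 ≤ 0 := by
      by_contra hcon
      have : 0 < (2 * lo * ‖x‖ ^ 2 + P.β * ‖gradient (objective A b) x‖ ^ P.δ) *
          ‖(WithLp.toLp 2 v - WithLp.toLp 2 w : Vec p)‖ ^ 2 :=
        mul_pos (by positivity) (not_le.1 hcon)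
      linarith
    have h4 : (WithLp.toLp 2 v - WithLp.toLp 2 w : Vec p) = 0 :=
      norm_eq_zero.1 (pow_eq_zero_iff two_ne_zero |>.1 (le_antisymm h3 (sq_nonneg _)))
    exact WithLp.toLp_injective 2 (sub_eq_zero.1 h4)
  have hdet := (Matrix.isUnit_iff_isUnit_det _).1 hunit
  change app (regMatrix A b P x) (-app (regMatrix A b P x)⁻¹ _) = _
  rw [app_neg, ← app_mul, Matrix.mul_nonsing_inv _ hdet, app_one]

theorem newtonDir_descent {lo hi : ℝ} (hF : FrameBounds A lo hi) (x : Vec p) :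
    (2 * lo * ‖x‖ ^ 2 + P.β * ‖gradient (objective A b) x‖ ^ P.δ) * ‖newtonDir A b P x‖ ^ 2 ≤
      -inner ℝ (gradient (objective A b) x) (newtonDir A b P x) := by
  refine (inner_regMatrix_self_ge (b := b) (P := P) hF x _).trans_eq ?_
  rw [regMatrix_app_newtonDir hF, inner_neg_right, real_inner_comm]

theorem norm_gradient_le_newtonDir {lo hi : ℝ} (hF : FrameBounds A lo hi) (x : Vec p) :
    ‖gradient (objective A b) x‖ ≤
      (2 * hi * ‖x‖ ^ 2 + P.β * ‖gradient (objective A b) x‖ ^ P.δ) *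
        ‖newtonDir A b P x‖ := by
  have h := norm_regMatrix_app_le (b := b) (P := P) hF x (newtonDir A b P x)
  rwa [regMatrix_app_newtonDir hF, norm_neg] at h

end Newton

/-! ### The sequence generated by the method -/

section Steps

variable {n p : ℕ} {A : Fin n → Matrix (Fin p) (Fin p) ℝ} (b : Fin n → ℝ) (P : Params)

theorem gradStep_eq (x : Vec p) :
    gradStep A b P x = x + P.α₁ ^ gradExponent A b P x • -gradient (objective A b) x := by
  rw [gradStep, smul_neg, sub_eq_add_neg]

theorem gradExponent_eq (x : Vec p) :
    gradExponent A b P x = sInf {j : ℕ |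
      objective A b (x + P.α₁ ^ j • -gradient (objective A b) x) ≤ objective A b x +
        P.μ₁ * P.α₁ ^ j *
          inner ℝ (gradient (objective A b) x) (-gradient (objective A b) x)} := by
  simp only [gradExponent, smul_neg, ← sub_eq_add_neg, inner_neg_right,
    real_inner_self_eq_norm_sq, mul_neg]

theorem grnm_succ (x₀ : Vec p) (k : ℕ) :
    grnm A b P x₀ (k + 1) = gradStep A b P (grnm A b P x₀ k) ∨
      grnm A b P x₀ (k + 1) = newtonStep A b P (grnm A b P x₀ k) := by
  simp only [grnm, grnmState]
  split_ifs
  · exact Or.inr rfl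
  · exact Or.inl rfl

end Steps

section Iteration

variable {n p : ℕ} [NeZero n] {A : Fin n → Matrix (Fin p) (Fin p) ℝ} (b : Fin n → ℝ)

/-- The decrease achieved by Armijo backtracking along a direction `d` that makes a uniform angle
with the negative gradient. -/
theorem armijo_step (hA : ∀ i, (A i).IsSymm) {lo hi : ℝ} (hF : FrameBounds A lo hi)
    {α μ m L : ℝ} (hα : α ∈ Set.Ioo (0 : ℝ) 1) (hμ : μ ∈ Set.Ioo (0 : ℝ) 1) (hm : 0 < m)
    (hL : 0 < L) (x d : Vec p) {j : ℕ}
    (hj : j = sInf {j : ℕ | objective A b (x + α ^ j • d) ≤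
      objective A b x + μ * α ^ j * inner ℝ (gradient (objective A b) x) d})
    (hd : m * ‖d‖ ^ 2 ≤ -inner ℝ (gradient (objective A b) x) d)
    (hLd : hi * (2 * ‖x‖ + ‖d‖) ^ 2 + specNorm (residualMean A b x) ≤ L) :
    objective A b (x + α ^ j • d) ≤ objective A b x -
        μ * min 1 (α * (1 - μ) / (L / m)) * (m * ‖d‖ ^ 2) ∧
      ‖x + α ^ j • d - x‖ ≤ ‖d‖ := by
  set a := inner ℝ (gradient (objective A b) x) d
  have hmd : 0 ≤ m * ‖d‖ ^ 2 := by positivity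
  have key := armijo_backtracking (φ := fun t => objective A b (x + t • d))
    (φ0 := objective A b x) (a := a) (K := L * ‖d‖ ^ 2) (B := L / m) hα hμ (by linarith)
    (div_pos hL hm) (by
      calc L * ‖d‖ ^ 2 = L / m * (m * ‖d‖ ^ 2) := by field_simp
        _ ≤ L / m * -a := by gcongr) (by
      intro t ht ht1
      have h1 := (abs_le.1 (abs_objective_add_sub_le b hA hF x (t • d))).2
      rw [← gradient_objective b hA hF, inner_smul_right] at h1
      have h2 : ‖t • d‖ = t * ‖d‖ := by rw [norm_smul, Real.norm_of_nonneg ht.le]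
      have h3 : t * ‖d‖ ≤ ‖d‖ := mul_le_of_le_one_left (norm_nonneg _) ht1
      have h4 : hi * (2 * ‖x‖ + t * ‖d‖) ^ 2 + specNorm (residualMean A b x) ≤ L := by
        refine le_trans ?_ hLd
        have := hF.hi_pos
        gcongr
      rw [h2] at h1
      have h5 := mul_le_mul_of_nonneg_right h4 (sq_nonneg (t * ‖d‖))
      change objective A b (x + t • d) ≤ _
      nlinarith)
  simp only [← hj] at key
  have hαj : 0 < α ^ j := pow_pos hα.1 j
  refine ⟨key.1.trans ?_, ?_⟩
  · have h1 := mul_le_mul_of_nonneg_left key.2 hμ.1.le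
    have h2 : μ * min 1 (α * (1 - μ) / (L / m)) * (m * ‖d‖ ^ 2) ≤ μ * α ^ j * -a :=
      mul_le_mul h1 hd hmd (mul_nonneg hμ.1.le hαj.le)
    linarith
  · rw [add_sub_cancel_left, norm_smul, Real.norm_of_nonneg hαj.le]
    exact mul_le_of_le_one_left (norm_nonneg _) (pow_le_one₀ hα.1.le hα.2.le)

/-- Local uniformity of the decrease: near a point where the directions `d y` are uniformly
gradient related, a step decreases the objective by a multiple of `‖∇f‖²` and has length at most a
multiple of `‖∇f‖`. -/
theorem exists_eventually_armijo_step (hA : ∀ i, (A i).IsSymm) {lo hi : ℝ}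
    (hF : FrameBounds A lo hi) {α μ m M : ℝ} (hα : α ∈ Set.Ioo (0 : ℝ) 1)
    (hμ : μ ∈ Set.Ioo (0 : ℝ) 1) (hm : 0 < m) (hM : 0 < M) {z : Vec p} {d : Vec p → Vec p}
    {s : Vec p → Vec p} {e : Vec p → ℕ}
    (he : ∀ x, e x = sInf {j : ℕ | objective A b (x + α ^ j • d x) ≤
      objective A b x + μ * α ^ j * inner ℝ (gradient (objective A b) x) (d x)})
    (hs : ∀ x, s x = x + α ^ e x • d x)
    (hd : ∀ᶠ x in 𝓝 z, m * ‖d x‖ ^ 2 ≤ -inner ℝ (gradient (objective A b) x) (d x))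
    (hg : ∀ᶠ x in 𝓝 z, ‖gradient (objective A b) x‖ ≤ M * ‖d x‖) :
    ∃ c > 0, ∃ C : ℝ, ∀ᶠ x in 𝓝 z,
      objective A b (s x) ≤ objective A b x - c * ‖gradient (objective A b) x‖ ^ 2 ∧
        ‖s x - x‖ ≤ C * ‖gradient (objective A b) x‖ := by
  have hhi := hF.hi_pos
  set G : Vec p → ℝ := fun x => ‖gradient (objective A b) x‖
  have hGc : Continuous G := (continuous_gradient_objective b hA hF).norm
  -- A bound for the curvature along all steps that start near `z`.
  let Λ : Vec p → ℝ := fun x =>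
    hi * (2 * ‖x‖ + G x / m) ^ 2 + specNorm (residualMean A b x)
  have hΛ : Continuous Λ := by
    have := continuous_specNorm_residualMean A b
    fun_prop
  have hΛ0 : 0 ≤ Λ z := add_nonneg (by positivity) (specNorm_nonneg _)
  have hL : 0 < Λ z + 1 := by linarith
  have hκ : 0 < min 1 (α * (1 - μ) / ((Λ z + 1) / m)) :=
    lt_min one_pos (div_pos (mul_pos hα.1 (sub_pos.2 hμ.2)) (div_pos hL hm))
  set κ := min 1 (α * (1 - μ) / ((Λ z + 1) / m))
  refine ⟨μ * κ * m / M ^ 2, div_pos (mul_pos (mul_pos hμ.1 hκ) hm) (by positivity), 1 / m, ?_⟩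
  filter_upwards [hd, hg, (hΛ.tendsto z).eventually (gt_mem_nhds (lt_add_one (Λ z)))]
    with x h1 h2 h3
  have h4 : ‖d x‖ ≤ G x / m := by
    have h5 : m * ‖d x‖ ^ 2 ≤ G x * ‖d x‖ :=
      h1.trans ((neg_le_abs _).trans (abs_real_inner_le_norm _ _))
    rw [le_div_iff₀ hm]
    rcases (norm_nonneg (d x)).eq_or_lt with h0 | h0
    · rw [← h0, zero_mul]; exact norm_nonneg _
    · nlinarith
  have h5 := armijo_step b hA hF hα hμ hm hL x (d x) (he x) h1 (by
    refine le_trans ?_ h3.le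
    change _ ≤ hi * (2 * ‖x‖ + G x / m) ^ 2 + specNorm (residualMean A b x)
    gcongr)
  rw [← hs x] at h5
  refine ⟨h5.1.trans ?_, h5.2.trans (h4.trans_eq (by ring))⟩
  have h6 : G x ^ 2 ≤ M ^ 2 * ‖d x‖ ^ 2 := by
    rw [← mul_pow]
    exact pow_le_pow_left₀ (norm_nonneg _) h2 2
  have h7 : μ * κ * m / M ^ 2 * G x ^ 2 ≤ μ * κ * (m * ‖d x‖ ^ 2) := by
    have h8 : 0 < μ * κ * m / M ^ 2 :=
      div_pos (mul_pos (mul_pos hμ.1 hκ) hm) (by positivity)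
    calc μ * κ * m / M ^ 2 * G x ^ 2 ≤ μ * κ * m / M ^ 2 * (M ^ 2 * ‖d x‖ ^ 2) := by gcongr
      _ = μ * κ * (m * ‖d x‖ ^ 2) := by field_simp
  exact sub_le_sub_left h7 _

variable (P : Params)

theorem objective_gradStep_le (hA : ∀ i, (A i).IsSymm) {lo hi : ℝ} (hF : FrameBounds A lo hi)
    (x : Vec p) : objective A b (gradStep A b P x) ≤ objective A b x := by
  set L := hi * (2 * ‖x‖ + ‖-gradient (objective A b) x‖) ^ 2 +
    specNorm (residualMean A b x) with hLdef
  have hL : 0 < L + 1 := by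
    have := hF.hi_pos
    have := specNorm_nonneg (residualMean A b x)
    positivity
  have h := (armijo_step b hA hF P.α₁_mem P.μ₁_mem one_pos hL x _
    (gradExponent_eq b P x) (by
      rw [norm_neg, inner_neg_right, real_inner_self_eq_norm_sq]; linarith)
    (by rw [← hLdef]; linarith)).1
  rw [gradStep_eq]
  refine h.trans (sub_le_self _ ?_)
  have h1 := P.μ₁_mem.1
  have h2 : 0 ≤ min 1 (P.α₁ * (1 - P.μ₁) / ((L + 1) / 1)) :=
    le_min zero_le_one (div_nonneg (mul_nonneg P.α₁_mem.1.le (sub_nonneg.2 P.μ₁_mem.2.le))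
      (by positivity))
  positivity

theorem objective_newtonStep_le (hA : ∀ i, (A i).IsSymm) {lo hi : ℝ}
    (hF : FrameBounds A lo hi) (x : Vec p) :
    objective A b (newtonStep A b P x) ≤ objective A b x := by
  by_cases hg : gradient (objective A b) x = 0
  · have hd : newtonDir A b P x = 0 := by rw [newtonDir, hg, app_zero, neg_zero]
    rw [newtonStep, hd, smul_zero, add_zero]
  set m := 2 * lo * ‖x‖ ^ 2 + P.β * ‖gradient (objective A b) x‖ ^ P.δ
  have hm : 0 < m := by
    have h1 : 0 < P.β * ‖gradient (objective A b) x‖ ^ P.δ :=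
      mul_pos P.β_pos (Real.rpow_pos_of_pos (norm_pos_iff.2 hg) _)
    have := hF.lo_pos
    positivity
  set L := hi * (2 * ‖x‖ + ‖newtonDir A b P x‖) ^ 2 + specNorm (residualMean A b x) with hLdef
  have hL : 0 < L + 1 := by
    have := hF.hi_pos
    have := specNorm_nonneg (residualMean A b x)
    positivity
  have h := (armijo_step b hA hF P.α₂_mem P.μ₂_mem hm hL x (newtonDir A b P x)
    (j := newtonExponent A b P x) rfl (newtonDir_descent hF x)
    (by rw [← hLdef]; linarith)).1
  rw [newtonStep]
  refine h.trans (sub_le_self _ ?_)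
  have h1 := P.μ₂_mem.1
  have h2 : 0 ≤ min 1 (P.α₂ * (1 - P.μ₂) / ((L + 1) / m)) :=
    le_min zero_le_one (div_nonneg (mul_nonneg P.α₂_mem.1.le (sub_nonneg.2 P.μ₂_mem.2.le))
      (by positivity))
  positivity

theorem antitone_objective_grnm (hA : ∀ i, (A i).IsSymm) {lo hi : ℝ}
    (hF : FrameBounds A lo hi) (x₀ : Vec p) : Antitone (objective A b ∘ grnm A b P x₀) := by
  refine antitone_nat_of_succ_le fun k => ?_
  rcases grnm_succ (A := A) b P x₀ k with h | h
  · simp only [Function.comp_apply, h]; exact objective_gradStep_le b P hA hF _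
  · simp only [Function.comp_apply, h]; exact objective_newtonStep_le b P hA hF _

/-- Near a nonzero point the Newton matrices are uniformly bounded and uniformly positive definite,
so that the steps of both phases are uniformly gradient related. -/
theorem exists_eventually_step (hA : ∀ i, (A i).IsSymm) {lo hi : ℝ} (hF : FrameBounds A lo hi)
    {z : Vec p} (hz : z ≠ 0) :
    ∃ c > 0, ∃ C : ℝ, ∀ᶠ x in 𝓝 z, ∀ y, y = gradStep A b P x ∨ y = newtonStep A b P x →
      objective A b y ≤ objective A b x - c * ‖gradient (objective A b) x‖ ^ 2 ∧
        ‖y - x‖ ≤ C * ‖gradient (objective A b) x‖ := by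
  obtain ⟨c₁, hc₁, C₁, h₁⟩ := exists_eventually_armijo_step b hA hF P.α₁_mem P.μ₁_mem one_pos
    one_pos (z := z) (gradExponent_eq b P) (gradStep_eq b P)
    (Eventually.of_forall fun x => by
      rw [norm_neg, inner_neg_right, real_inner_self_eq_norm_sq]; linarith)
    (Eventually.of_forall fun x => by rw [norm_neg, one_mul])
  have hlo := hF.lo_pos
  have hhi := hF.hi_pos
  have hβ := P.β_pos
  have hz' : 0 < ‖z‖ := norm_pos_iff.2 hz
  set G : Vec p → ℝ := fun x => ‖gradient (objective A b) x‖
  have hGc : Continuous G := (continuous_gradient_objective b hA hF).norm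
  have hMc : Continuous fun x : Vec p => 2 * hi * ‖x‖ ^ 2 + P.β * G x ^ P.δ := by
    have := hGc.rpow_const (p := P.δ) fun x => Or.inr P.δ_mem.1.le
    fun_prop
  have hmc : Continuous fun x : Vec p => 2 * lo * ‖x‖ ^ 2 := by fun_prop
  have hGz : 0 ≤ G z ^ P.δ := Real.rpow_nonneg (norm_nonneg _) _
  obtain ⟨c₂, hc₂, C₂, h₂⟩ := exists_eventually_armijo_step b hA hF P.α₂_mem P.μ₂_mem
    (m := lo * ‖z‖ ^ 2) (M := 2 * hi * ‖z‖ ^ 2 + P.β * G z ^ P.δ + 1)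
    (by positivity) (by positivity) (z := z) (d := newtonDir A b P)
    (s := newtonStep A b P) (e := newtonExponent A b P) (fun x => rfl) (fun x => rfl)
    (by
      filter_upwards [(hmc.tendsto z).eventually (lt_mem_nhds
        (show lo * ‖z‖ ^ 2 < 2 * lo * ‖z‖ ^ 2 by nlinarith [mul_pos hlo (pow_pos hz' 2)]))]
        with x hx
      refine le_trans ?_ (newtonDir_descent (b := b) (P := P) hF x)
      have := regularization_nonneg (A := A) (b := b) (P := P) x
      gcongr
      linarith)
    (by
      filter_upwards [(hMc.tendsto z).eventually (gt_mem_nhds (lt_add_one _))] with x hx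
      refine (norm_gradient_le_newtonDir (b := b) (P := P) hF x).trans ?_
      gcongr)
  refine ⟨min c₁ c₂, lt_min hc₁ hc₂, max C₁ C₂, ?_⟩
  filter_upwards [h₁, h₂] with x hx₁ hx₂ y hy
  have hm₁ : min c₁ c₂ * G x ^ 2 ≤ c₁ * G x ^ 2 := by gcongr; exact min_le_left _ _
  have hm₂ : min c₁ c₂ * G x ^ 2 ≤ c₂ * G x ^ 2 := by gcongr; exact min_le_right _ _
  have hM₁ : C₁ * G x ≤ max C₁ C₂ * G x :=
    mul_le_mul_of_nonneg_right (le_max_left _ _) (norm_nonneg _)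
  have hM₂ : C₂ * G x ≤ max C₁ C₂ * G x :=
    mul_le_mul_of_nonneg_right (le_max_right _ _) (norm_nonneg _)
  rcases hy with rfl | rfl
  · exact ⟨hx₁.1.trans (by linarith), hx₁.2.trans hM₁⟩
  · exact ⟨hx₂.1.trans (by linarith), hx₂.2.trans hM₂⟩

theorem gradient_eq_zero_of_mapClusterPt_grnm (hA : ∀ i, (A i).IsSymm) {lo hi : ℝ}
    (hF : FrameBounds A lo hi) {x₀ z : Vec p} (hz : z ≠ 0)
    (hcl : MapClusterPt z atTop (grnm A b P x₀)) : gradient (objective A b) z = 0 := by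
  obtain ⟨c, hc, C, h⟩ := exists_eventually_step b P hA hF hz
  refine norm_eq_zero.1 (eq_zero_of_mapClusterPt_of_decrease
    (G := fun x => ‖gradient (objective A b) x‖) (continuous_objective A b)
    (continuous_gradient_objective b hA hF).norm (antitone_objective_grnm b P hA hF x₀)
    hcl hc ?_)
  filter_upwards [h] with y hy k hk
  subst hk
  exact (hy _ (grnm_succ b P x₀ k)).1

theorem tendsto_grnm (hA : ∀ i, (A i).IsSymm) {lo hi : ℝ} (hF : FrameBounds A lo hi)
    {x₀ z : Vec p} (hz : z ≠ 0) (hcl : MapClusterPt z atTop (grnm A b P x₀))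
    (hS : specNorm (residualMean A b z) < 2 * lo * ‖z‖ ^ 2) :
    Tendsto (grnm A b P x₀) atTop (𝓝 z) := by
  have hg := gradient_eq_zero_of_mapClusterPt_grnm b P hA hF hz hcl
  obtain ⟨c, hc, C, h⟩ := exists_eventually_step b P hA hF hz
  obtain ⟨q, hq, hgrow⟩ := eventually_quadratic_growth b hA hF
    (by rw [← gradient_objective b hA hF, hg]) hS
  refine tendsto_of_mapClusterPt_of_quadratic_growth (C := C)
    (G := fun x => ‖gradient (objective A b) x‖) (continuous_objective A b)
    (continuous_gradient_objective b hA hF).norm (by rw [hg, norm_zero])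
    (antitone_objective_grnm b P hA hF x₀) hcl hq ?_ ?_
  · filter_upwards [h] with y hy k hk
    subst hk
    rw [dist_eq_norm]
    exact (hy _ (grnm_succ b P x₀ k)).2
  · simpa only [dist_eq_norm] using hgrow

end Iteration

/-! ### Stationary points under small noise -/

section Landscape

variable {n p : ℕ} {A : Fin n → Matrix (Fin p) (Fin p) ℝ} {xs : Vec p} {e : Fin n → ℝ}

theorem residual_observations (hA : ∀ i, (A i).IsSymm) (i : Fin n) (x : Vec p) :
    residual A (observations A xs e) i x = inner ℝ (x - xs) (app (A i) (x + xs)) - e i := by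
  simp only [residual, observations, app_add, inner_sub_left, inner_add_right,
    inner_app_comm (hA i) x xs]
  ring

theorem specNorm_residualMean_le (hA : ∀ i, (A i).IsSymm) {lo hi : ℝ}
    (hF : FrameBounds A lo hi) (x : Vec p) :
    specNorm (residualMean A (observations A xs e) x) ≤
      hi * (‖x - xs‖ * ‖x + xs‖) + specNorm (weightedMean A e) := by
  have hhi := hF.hi_pos
  refine specNorm_le_of_abs_inner_le
    (add_nonneg (by positivity) (specNorm_nonneg _)) fun u v => ?_
  have h1 := hF.mean_mul_le (x - xs) (x + xs) u v
  have h2 := abs_inner_app_le (weightedMean A e) u v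
  have h3 : inner ℝ u (app (residualMean A (observations A xs e) x) v) =
      (1 / (n : ℝ)) * ∑ i, inner ℝ (x - xs) (app (A i) (x + xs)) * inner ℝ u (app (A i) v) -
        inner ℝ u (app (weightedMean A e) v) := by
    rw [residualMean, inner_weightedMean, inner_weightedMean, ← mul_sub,
      ← Finset.sum_sub_distrib]
    simp only [residual_observations hA, sub_mul]
  rw [h3]
  refine (abs_sub _ _).trans ?_
  linarith

/-- At a stationary point whose Hessian dominates its residual part, the distances to `xs` and
`-xs` have a product bounded by the noise level. Stationarity says that the symmetric matrix
`S = residualMean A b x` annihilates `x`, so the quadratic form of `S` at `xs` only sees the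
component of `xs` orthogonal to `x`; this bounds the mean of the squares
`(⟨x, A_i x⟩ - ⟨xs, A_i xs⟩)²` from above, while the lower frame bound bounds it from below. -/
theorem mul_norm_sub_mul_norm_add_le (hA : ∀ i, (A i).IsSymm) {lo hi : ℝ}
    (hF : FrameBounds A lo hi) {x : Vec p} (hx : x ≠ 0)
    (hstat : app (residualMean A (observations A xs e) x) x = 0)
    (hS : specNorm (residualMean A (observations A xs e) x) < 2 * lo * ‖x‖ ^ 2) :
    lo * (‖x - xs‖ * ‖x + xs‖) ≤ 2 * specNorm (weightedMean A e) := by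
  have hlo := hF.lo_pos
  set S := residualMean A (observations A xs e) x with hSdef
  set N := specNorm (weightedMean A e)
  set D := ‖x - xs‖ * ‖x + xs‖ with hD
  have hx0 : 0 < ‖x‖ := norm_pos_iff.2 hx
  have hSsymm : S.IsSymm := isSymm_weightedMean hA _
  -- The component of `xs` orthogonal to `x`.
  set τ := inner ℝ x xs / ‖x‖ ^ 2 with hτ
  set w := xs - τ • x with hw
  have hquad : inner ℝ xs (app S xs) = inner ℝ w (app S w) := by
    have h1 : app S w = app S xs := by rw [hw, app_sub, app_smul, hstat, smul_zero, sub_zero]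
    have h2 : inner ℝ x (app S xs) = 0 := by rw [inner_app_comm hSsymm, hstat, inner_zero_right]
    rw [h1, hw, inner_sub_left, inner_smul_left, h2, mul_zero, sub_zero]
  have hwnorm : ‖x‖ ^ 2 * ‖w‖ ^ 2 = ‖x‖ ^ 2 * ‖xs‖ ^ 2 - (inner ℝ x xs) ^ 2 := by
    rw [hw, norm_sub_sq_real, inner_smul_right, norm_smul, mul_pow, Real.norm_eq_abs, sq_abs,
      real_inner_comm, hτ]
    field_simp
    ring
  have hwquad : -inner ℝ xs (app S xs) ≤ 2 * lo * (‖x‖ ^ 2 * ‖w‖ ^ 2) := by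
    rw [hquad]
    have h1 := (abs_le.1 (abs_inner_app_le S w w)).1
    have h2 := mul_le_mul_of_nonneg_right hS.le (sq_nonneg ‖w‖)
    linarith
  have hmean : (1 / (n : ℝ)) * ∑ i, (inner ℝ (x - xs) (app (A i) (x + xs))) ^ 2 =
      -inner ℝ xs (app S xs) + inner ℝ (x - xs) (app (weightedMean A e) (x + xs)) := by
    have h1 : -inner ℝ xs (app S xs) = inner ℝ x (app S x) - inner ℝ xs (app S xs) := by
      rw [hstat, inner_zero_right, zero_sub]
    rw [h1, hSdef, residualMean, inner_weightedMean, inner_weightedMean, inner_weightedMean,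
      ← mul_sub, ← mul_add, ← Finset.sum_sub_distrib, ← Finset.sum_add_distrib]
    congr 1
    refine Finset.sum_congr rfl fun i _ => ?_
    have h2 : inner ℝ (x - xs) (app (A i) (x + xs)) =
        inner ℝ x (app (A i) x) - inner ℝ xs (app (A i) xs) := by
      simp only [app_add, inner_sub_left, inner_add_right, inner_app_comm (hA i) x xs]
      ring
    rw [residual_observations hA, h2]
    ring
  have hupper : lo * D ^ 2 ≤
      2 * lo * (‖x‖ ^ 2 * ‖xs‖ ^ 2 - (inner ℝ x xs) ^ 2) + N * D := by
    have h1 := hF.lower (x - xs) (x + xs)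
    have h2 := (abs_le.1 (abs_inner_app_le (weightedMean A e) (x - xs) (x + xs))).2
    rw [hmean] at h1
    rw [hwnorm] at hwquad
    calc lo * D ^ 2 = lo * ‖x - xs‖ ^ 2 * ‖x + xs‖ ^ 2 := by rw [hD]; ring
      _ ≤ _ := h1
      _ ≤ 2 * lo * (‖x‖ ^ 2 * ‖xs‖ ^ 2 - (inner ℝ x xs) ^ 2) + N * D := by
        refine add_le_add hwquad (h2.trans_eq ?_)
        rw [hD]; ring
  have hDsq : D ^ 2 = (‖x‖ ^ 2 + ‖xs‖ ^ 2) ^ 2 - 4 * (inner ℝ x xs) ^ 2 := by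
    rw [hD, mul_pow, norm_sub_sq_real, norm_add_sq_real]; ring
  have hhalf : lo * D ^ 2 ≤ 2 * N * D := by
    nlinarith [mul_nonneg hlo.le (sq_nonneg (‖x‖ ^ 2 - ‖xs‖ ^ 2))]
  have hD0 : 0 ≤ D := by positivity
  rcases hD0.eq_or_lt with h0 | h0
  · rw [← h0, mul_zero]
    exact mul_nonneg zero_le_two (specNorm_nonneg _)
  · refine le_of_mul_le_mul_right ?_ h0
    linarith

theorem min_norm_mul_norm_le (x y : Vec p) :
    min ‖x - y‖ ‖x + y‖ * ‖y‖ ≤ ‖x - y‖ * ‖x + y‖ := by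
  have h1 : ‖y‖ ≤ max ‖x - y‖ ‖x + y‖ := by
    have h2 : ‖(2 : ℝ) • y‖ ≤ ‖x + y‖ + ‖x - y‖ := by
      have : (2 : ℝ) • y = (x + y) - (x - y) := by rw [two_smul]; abel
      rw [this]; exact norm_sub_le _ _
    rw [norm_smul, Real.norm_of_nonneg zero_le_two] at h2
    have h3 := le_max_left ‖x - y‖ ‖x + y‖
    have h4 := le_max_right ‖x - y‖ ‖x + y‖
    linarith
  calc min ‖x - y‖ ‖x + y‖ * ‖y‖ ≤ min ‖x - y‖ ‖x + y‖ * max ‖x - y‖ ‖x + y‖ := by gcongr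
    _ = ‖x - y‖ * ‖x + y‖ := min_mul_max _ _

theorem norm_sq_sub_norm_sq_le (x y : Vec p) :
    ‖y‖ ^ 2 - ‖x‖ ^ 2 ≤ ‖x - y‖ * ‖x + y‖ := by
  have h : inner ℝ (x - y) (x + y) = ‖x‖ ^ 2 - ‖y‖ ^ 2 := by
    rw [inner_sub_left, inner_add_right, inner_add_right, real_inner_self_eq_norm_sq,
      real_inner_self_eq_norm_sq, real_inner_comm x y]
    ring
  have h2 := (abs_le.1 (abs_real_inner_le_norm (x - y) (x + y))).1
  linarith

/-- A stationary point with a small residual part of the Hessian is a global minimizer. The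
objective is even, so a competitor `y` may be replaced by `-y`, and one of the two satisfies
`‖x‖ ≤ ‖y + x‖`. -/
theorem objective_le_of_stationary [NeZero n] (b : Fin n → ℝ) (hA : ∀ i, (A i).IsSymm) {lo hi : ℝ}
    (hF : FrameBounds A lo hi) {x : Vec p} (hx : app (residualMean A b x) x = 0)
    (hS : specNorm (residualMean A b x) ≤ lo / 2 * ‖x‖ ^ 2) (y : Vec p) :
    objective A b x ≤ objective A b y := by
  have hlo := hF.lo_pos
  have main : ∀ z : Vec p, ‖x‖ ≤ ‖z + x‖ → objective A b x ≤ objective A b z := by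
    intro z hz
    refine le_trans ?_ (objective_lower_of_stationary b hA hF hx z)
    have h1 : ‖x‖ ^ 2 ≤ ‖z + x‖ ^ 2 := by gcongr
    have h2 : 0 ≤ lo / 4 * ‖z + x‖ ^ 2 - specNorm (residualMean A b x) / 2 := by nlinarith
    exact le_add_of_nonneg_right (mul_nonneg h2 (sq_nonneg _))
  rcases le_total ‖x‖ ‖y + x‖ with h | h
  · exact main y h
  · rw [← objective_neg A b y]
    refine main (-y) ?_
    have h2 : ‖(2 : ℝ) • x‖ ≤ ‖y + x‖ + ‖-y + x‖ := by
      have : (2 : ℝ) • x = (y + x) + (-y + x) := by rw [two_smul]; abel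
      rw [this]; exact norm_add_le _ _
    rw [norm_smul, Real.norm_of_nonneg zero_le_two] at h2
    linarith

/-- If the noise level is at most `lo² ‖xs‖² / (4 (lo + hi))`, a nondegenerate stationary point is
a global minimizer. -/
theorem objective_le_of_stationary_of_noise_le [NeZero n] (hA : ∀ i, (A i).IsSymm) {lo hi : ℝ}
    (hF : FrameBounds A lo hi) {x : Vec p} (hx : x ≠ 0)
    (hstat : app (residualMean A (observations A xs e) x) x = 0)
    (hS : specNorm (residualMean A (observations A xs e) x) < 2 * lo * ‖x‖ ^ 2)
    (hN : 4 * (lo + hi) * specNorm (weightedMean A e) ≤ lo ^ 2 * ‖xs‖ ^ 2) (y : Vec p) :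
    objective A (observations A xs e) x ≤ objective A (observations A xs e) y := by
  have hlo := hF.lo_pos
  have hhi := hF.hi_pos
  refine objective_le_of_stationary _ hA hF hstat ?_ y
  have h1 := mul_norm_sub_mul_norm_add_le hA hF hx hstat hS
  have h2 := specNorm_residualMean_le (e := e) (xs := xs) hA hF x
  have h3 := norm_sq_sub_norm_sq_le x xs
  refine h2.trans ?_
  set D := ‖x - xs‖ * ‖x + xs‖
  refine le_of_mul_le_mul_left ?_ hlo
  have h4 := mul_le_mul_of_nonneg_left h1 hhi.le
  have h5 := mul_le_mul_of_nonneg_left h3 (sq_nonneg lo)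
  have h6 := mul_le_mul_of_nonneg_left h1 hlo.le
  nlinarith

end Landscape

/-! ### Nets of the unit sphere -/

section Nets

variable {p : ℕ}

/-- The volume bound for separated subsets of the unit ball: balls of radius `η / 2` around the
points are disjoint and lie in a ball of radius `1 + η / 2`. -/
theorem card_le_of_separated {η : ℝ} (hη : 0 < η) (s : Finset (Vec p)) (hs : ∀ c ∈ s, ‖c‖ ≤ 1)
    (hsep : ∀ c ∈ s, ∀ d ∈ s, c ≠ d → η ≤ ‖c - d‖) : (s.card : ℝ) ≤ (1 + 2 / η) ^ p := by
  set δ := η / 2 with hδdef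
  have hδ : 0 < δ := half_pos hη
  have hρ : 0 < 1 + δ := by positivity
  let μ : Measure (Vec p) := volume
  have hdisj : Set.Pairwise (s : Set (Vec p))
      (Function.onFun Disjoint fun c => Metric.ball c δ) := by
    rintro c hc d hd hcd
    refine Metric.ball_disjoint_ball ?_
    rw [dist_eq_norm]
    have := hsep c hc d hd hcd
    linarith
  have hsub : (⋃ c ∈ s, Metric.ball c δ) ⊆ Metric.ball (0 : Vec p) (1 + δ) := by
    refine Set.iUnion₂_subset fun c hc => ?_
    refine Metric.ball_subset_ball' ?_
    rw [dist_zero_right]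
    have := hs c hc
    linarith
  have hvol : (s.card : ENNReal) * ENNReal.ofReal (δ ^ p) * μ (Metric.ball 0 1) ≤
      ENNReal.ofReal ((1 + δ) ^ p) * μ (Metric.ball 0 1) := by
    have hfin : Module.finrank ℝ (Vec p) = p := finrank_euclideanSpace_fin
    calc (s.card : ENNReal) * ENNReal.ofReal (δ ^ p) * μ (Metric.ball 0 1)
        = μ (⋃ c ∈ s, Metric.ball c δ) := by
          rw [measure_biUnion_finset hdisj fun c _ => measurableSet_ball]
          simp only [μ.addHaar_ball_of_pos _ hδ, hfin]
          simp only [Finset.sum_const, nsmul_eq_mul, mul_assoc]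
      _ ≤ μ (Metric.ball (0 : Vec p) (1 + δ)) := measure_mono hsub
      _ = ENNReal.ofReal ((1 + δ) ^ p) * μ (Metric.ball 0 1) := by
          simp only [μ.addHaar_ball_of_pos _ hρ, hfin]
  have hcard : (s.card : ENNReal) * ENNReal.ofReal (δ ^ p) ≤ ENNReal.ofReal ((1 + δ) ^ p) :=
    (ENNReal.mul_le_mul_iff_left (Metric.measure_ball_pos _ _ zero_lt_one).ne'
      measure_ball_lt_top.ne).1 hvol
  have hreal := ENNReal.toReal_le_of_le_ofReal (pow_nonneg hρ.le p) hcard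
  rw [ENNReal.toReal_mul, ENNReal.toReal_natCast, ENNReal.toReal_ofReal (by positivity)] at hreal
  have hquot : 1 + 2 / η = (1 + δ) / δ := by rw [hδdef]; field_simp; ring
  rw [hquot, div_pow, le_div_iff₀ (by positivity)]
  exact hreal

/-- The unit sphere has a `1/4`-net of at most `9 ^ p` points. -/
theorem exists_quarter_net (p : ℕ) :
    ∃ s : Finset (Vec p), (s.card : ℝ) ≤ 9 ^ p ∧ (∀ v ∈ s, ‖v‖ = 1) ∧
      ∀ u : Vec p, ‖u‖ = 1 → ∃ v ∈ s, ‖u - v‖ ≤ 1 / 4 := by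
  classical
  let Sep : Finset (Vec p) → Prop := fun s =>
    (∀ v ∈ s, ‖v‖ = 1) ∧ ∀ c ∈ s, ∀ d ∈ s, c ≠ d → (1 / 4 : ℝ) ≤ ‖c - d‖
  have hcard : ∀ s, Sep s → (s.card : ℝ) ≤ 9 ^ p := by
    intro s hs
    refine (card_le_of_separated (by norm_num : (0 : ℝ) < 1 / 4) s
      (fun c hc => (hs.1 c hc).le) hs.2).trans_eq ?_
    norm_num
  -- A separated set of maximal cardinality is a net.
  have hbdd : ∀ k ∈ {k : ℕ | ∃ s, Sep s ∧ s.card = k}, k ≤ 9 ^ p := by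
    rintro k ⟨s, hs, rfl⟩
    exact_mod_cast hcard s hs
  obtain ⟨s, hs, hmax⟩ := Nat.sSup_mem (s := {k : ℕ | ∃ s, Sep s ∧ s.card = k})
    ⟨0, ∅, ⟨by simp, by simp⟩, rfl⟩ ⟨9 ^ p, hbdd⟩
  refine ⟨s, hcard s hs, hs.1, fun u hu => ?_⟩
  by_contra! hfar
  have hus : u ∉ s := fun h => by
    have := hfar u h
    rw [sub_self, norm_zero] at this
    norm_num at this
  have hins : Sep (insert u s) := by
    refine ⟨?_, ?_⟩
    · intro v hv
      rcases Finset.mem_insert.1 hv with rfl | hv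
      · exact hu
      · exact hs.1 v hv
    · intro c hc d hd hcd
      rcases Finset.mem_insert.1 hc with hcu | hc <;>
        rcases Finset.mem_insert.1 hd with hdu | hd
      · exact absurd (hcu.trans hdu.symm) hcd
      · rw [hcu]; exact (hfar d hd).le
      · rw [hdu, norm_sub_rev]; exact (hfar c hc).le
      · exact hs.2 c hc d hd hcd
  have hle : (insert u s).card ≤ s.card := by
    rw [hmax]
    exact le_csSup ⟨9 ^ p, hbdd⟩ ⟨insert u s, hins, rfl⟩
  rw [Finset.card_insert_of_notMem hus] at hle
  omega

/-- For a symmetric matrix, a bound of the quadratic form bounds the spectral norm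
(polarization). -/
theorem specNorm_le_of_quadratic {M : Matrix (Fin p) (Fin p) ℝ} (hM : M.IsSymm) {q : ℝ}
    (hq : 0 ≤ q) (h : ∀ u : Vec p, ‖u‖ = 1 → |inner ℝ u (app M u)| ≤ q) : specNorm M ≤ q := by
  have hall : ∀ u : Vec p, |inner ℝ u (app M u)| ≤ q * ‖u‖ ^ 2 := by
    intro u
    by_cases hu : u = 0
    · simp [hu]
    have hu0 : ‖u‖ ≠ 0 := norm_ne_zero_iff.2 hu
    have h1 := h (‖u‖⁻¹ • u) (norm_smul_inv_norm (𝕜 := ℝ) hu)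
    rw [app_smul, inner_smul_right, inner_smul_left, RCLike.conj_to_real, ← mul_assoc, abs_mul,
      abs_of_nonneg (by positivity)] at h1
    calc |inner ℝ u (app M u)|
        = ‖u‖⁻¹ * ‖u‖⁻¹ * |inner ℝ u (app M u)| * ‖u‖ ^ 2 := by field_simp
      _ ≤ q * ‖u‖ ^ 2 := by gcongr
  have hunit : ∀ u v : Vec p, ‖u‖ = 1 → ‖v‖ = 1 → |inner ℝ u (app M v)| ≤ q := by
    intro u v hu hv
    have h1 := abs_le.1 (hall (u + v))
    have h2 := abs_le.1 (hall (u - v))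
    have h3 : inner ℝ (u + v) (app M (u + v)) - inner ℝ (u - v) (app M (u - v)) =
        4 * inner ℝ u (app M v) := by
      simp only [app_add, app_sub, inner_add_left, inner_add_right, inner_sub_left,
        inner_sub_right, inner_app_comm hM v u]
      ring
    have h4 := parallelogram_law_with_norm ℝ u v
    rw [hu, hv] at h4
    have h5 : q * ‖u + v‖ ^ 2 + q * ‖u - v‖ ^ 2 = 4 * q := by
      linear_combination q * h4
    rw [abs_le]
    constructor <;> linarith
  refine specNorm_le_of_abs_inner_le hq fun u v => ?_
  by_cases hu : u = 0
  · simp [hu]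
  by_cases hv : v = 0
  · simp [hv, app_zero]
  have hu0 : ‖u‖ ≠ 0 := norm_ne_zero_iff.2 hu
  have hv0 : ‖v‖ ≠ 0 := norm_ne_zero_iff.2 hv
  have h1 := hunit (‖u‖⁻¹ • u) (‖v‖⁻¹ • v) (norm_smul_inv_norm (𝕜 := ℝ) hu)
    (norm_smul_inv_norm (𝕜 := ℝ) hv)
  rw [app_smul, inner_smul_right, inner_smul_left, RCLike.conj_to_real, ← mul_assoc, abs_mul,
    abs_of_nonneg (by positivity)] at h1
  calc |inner ℝ u (app M v)|
      = ‖v‖⁻¹ * ‖u‖⁻¹ * |inner ℝ u (app M v)| * (‖u‖ * ‖v‖) := by field_simp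
    _ ≤ q * (‖u‖ * ‖v‖) := by gcongr
    _ = q * ‖u‖ * ‖v‖ := by ring

theorem specNorm_le_two_mul_of_net {M : Matrix (Fin p) (Fin p) ℝ} (hM : M.IsSymm)
    {s : Finset (Vec p)} (hs : ∀ v ∈ s, ‖v‖ = 1)
    (hnet : ∀ u : Vec p, ‖u‖ = 1 → ∃ v ∈ s, ‖u - v‖ ≤ 1 / 4) {t : ℝ} (ht : 0 ≤ t)
    (h : ∀ v ∈ s, |inner ℝ v (app M v)| ≤ t) : specNorm M ≤ 2 * t := by
  have hK := specNorm_nonneg M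
  have key : specNorm M ≤ t + specNorm M / 2 := by
    refine specNorm_le_of_quadratic hM (by positivity) fun u hu => ?_
    obtain ⟨v, hv, huv⟩ := hnet u hu
    have h1 : inner ℝ u (app M u) =
        inner ℝ v (app M v) + (inner ℝ (u - v) (app M u) + inner ℝ v (app M (u - v))) := by
      simp only [app_sub, inner_sub_left, inner_sub_right]
      ring
    have h2 : |inner ℝ (u - v) (app M u)| ≤ specNorm M * (1 / 4) := by
      refine (abs_inner_app_le M _ _).trans ?_
      rw [hu, mul_one]; gcongr
    have h3 : |inner ℝ v (app M (u - v))| ≤ specNorm M * (1 / 4) := by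
      refine (abs_inner_app_le M _ _).trans ?_
      rw [hs v hv, mul_one]; gcongr
    rw [h1]
    refine (abs_add_le _ _).trans ?_
    have h4 := abs_add_le (inner ℝ (u - v) (app M u)) (inner ℝ v (app M (u - v)))
    have h5 := h v hv
    linarith
  linarith

end Nets

/-! ### Concentration of the noise -/

section Noise

variable {Ω : Type*} [MeasurableSpace Ω] {μ : Measure Ω} {n p : ℕ} [NeZero n]

theorem measureReal_sum_mul_ge_le {ε : Fin n → Ω → ℝ} {ς : ℝ} (hε : SubGaussianNoise μ ε ς)
    (w : Fin n → ℝ) {V t : ℝ} (hw : 0 < ∑ i, w i ^ 2) (hV : ς ^ 2 * ∑ i, w i ^ 2 ≤ V)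
    (ht : 0 ≤ t) :
    μ.real {ω | t ≤ ∑ i, w i * ε i ω} ≤ Real.exp (-t ^ 2 / (2 * V)) := by
  have hς := hε.proxy_pos
  have hind : iIndepFun (fun i ω => w i * ε i ω) μ :=
    hε.indep.comp (fun i y => w i * y) fun i => measurable_const_mul (w i)
  have h := HasSubgaussianMGF.measure_sum_ge_le_of_iIndepFun hind (s := Finset.univ)
    (fun i _ => (hε.subGaussian i).const_mul (w i)) ht
  refine h.trans (Real.exp_le_exp.2 ?_)
  push_cast
  have hsum : ∑ i, w i ^ 2 * (Real.toNNReal (ς ^ 2) : ℝ) = ς ^ 2 * ∑ i, w i ^ 2 := by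
    rw [← Finset.sum_mul, Real.coe_toNNReal _ (sq_nonneg ς), mul_comm]
  have h1 : 0 < ς ^ 2 * ∑ i, w i ^ 2 := by positivity
  change -t ^ 2 / (2 * ∑ i, w i ^ 2 * (Real.toNNReal (ς ^ 2) : ℝ)) ≤ _
  rw [hsum, neg_div, neg_div]
  gcongr

theorem measureReal_abs_sum_mul_ge_le [IsProbabilityMeasure μ] {ε : Fin n → Ω → ℝ} {ς : ℝ}
    (hε : SubGaussianNoise μ ε ς) (w : Fin n → ℝ) {V t : ℝ} (hw : 0 < ∑ i, w i ^ 2)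
    (hV : ς ^ 2 * ∑ i, w i ^ 2 ≤ V) (ht : 0 ≤ t) :
    μ.real {ω | t ≤ |∑ i, w i * ε i ω|} ≤ 2 * Real.exp (-t ^ 2 / (2 * V)) := by
  have h1 := measureReal_sum_mul_ge_le hε w hw hV ht
  have h2 := measureReal_sum_mul_ge_le hε (fun i => -w i) (by simpa using hw)
    (by simpa using hV) ht
  have hsub : {ω | t ≤ |∑ i, w i * ε i ω|} ⊆
      {ω | t ≤ ∑ i, w i * ε i ω} ∪ {ω | t ≤ ∑ i, -w i * ε i ω} := by
    intro ω hω
    rcases le_abs.1 (show t ≤ |∑ i, w i * ε i ω| from hω) with h | h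
    · exact Or.inl h
    · refine Or.inr ?_
      change t ≤ ∑ i, -w i * ε i ω
      simpa only [neg_mul, Finset.sum_neg_distrib] using h
  calc μ.real {ω | t ≤ |∑ i, w i * ε i ω|}
      ≤ μ.real ({ω | t ≤ ∑ i, w i * ε i ω} ∪ {ω | t ≤ ∑ i, -w i * ε i ω}) :=
        measureReal_mono hsub
    _ ≤ _ := measureReal_union_le _ _
    _ ≤ 2 * Real.exp (-t ^ 2 / (2 * V)) := by linarith

/-- With high probability the noise matrix `(1 / n) ∑ i, ε_i A_i` is small. The union bound over
the net costs `9 ^ p ≤ (1 + 2 n) ^ (2 p)`, which two thirds of the Gaussian exponent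
`3 p log (1 + 2 n)` pay for. -/
theorem measureReal_specNorm_noise_gt_le [IsProbabilityMeasure μ]
    {A : Fin n → Matrix (Fin p) (Fin p) ℝ}
    (hA : ∀ i, (A i).IsSymm) {lo hi : ℝ} (hF : FrameBounds A lo hi) {ε : Fin n → Ω → ℝ} {ς : ℝ}
    (hε : SubGaussianNoise μ ε ς) :
    μ.real {ω | 2 * Real.sqrt (6 * ς ^ 2 * hi * (p : ℝ) * Real.log (1 + 2 * (n : ℝ)) / (n : ℝ)) <
      specNorm (weightedMean A fun i => ε i ω)} ≤ prob₁ n p := by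
  have hn : (0 : ℝ) < n := Nat.cast_pos.2 (NeZero.pos n)
  have hn1 : (1 : ℝ) ≤ n := by exact_mod_cast NeZero.pos n
  have hς := hε.proxy_pos
  have hhi := hF.hi_pos
  set ℓ := Real.log (1 + 2 * (n : ℝ)) with hℓ
  have hℓ0 : 0 ≤ ℓ := Real.log_nonneg (by linarith)
  have hexp : Real.exp ℓ = 1 + 2 * (n : ℝ) := Real.exp_log (by linarith)
  set t := Real.sqrt (6 * ς ^ 2 * hi * (p : ℝ) * ℓ / (n : ℝ)) with ht
  have ht0 : 0 ≤ t := Real.sqrt_nonneg _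
  have htsq : t ^ 2 = 6 * ς ^ 2 * hi * (p : ℝ) * ℓ / (n : ℝ) := Real.sq_sqrt (by positivity)
  obtain ⟨s, hcard, hs, hnet⟩ := exists_quarter_net p
  set X : Vec p → Ω → ℝ := fun v ω => ∑ i, (1 / (n : ℝ) * inner ℝ v (app (A i) v)) * ε i ω
  have hX : ∀ v ω, inner ℝ v (app (weightedMean A fun i => ε i ω) v) = X v ω := by
    intro v ω
    rw [inner_weightedMean, Finset.mul_sum]
    exact Finset.sum_congr rfl fun i _ => by ring
  have hsub : {ω | 2 * t < specNorm (weightedMean A fun i => ε i ω)} ⊆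
      ⋃ v ∈ s, {ω | t ≤ |X v ω|} := by
    intro ω hω
    by_contra hcon
    simp only [Set.mem_iUnion, Set.mem_ofPred_eq, not_exists, not_le] at hcon
    refine not_lt.2 ?_ (show 2 * t < specNorm (weightedMean A fun i => ε i ω) from hω)
    refine specNorm_le_two_mul_of_net (isSymm_weightedMean hA _) hs hnet ht0 fun v hv => ?_
    rw [hX]
    exact (hcon v hv).le
  have hone : ∀ v ∈ s, μ.real {ω | t ≤ |X v ω|} ≤ 2 * Real.exp (-(3 * (p * ℓ))) := by
    intro v hv
    have hsq : ∑ i, (1 / (n : ℝ) * inner ℝ v (app (A i) v)) ^ 2 =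
        (1 / (n : ℝ)) * ((1 / (n : ℝ)) * ∑ i, (inner ℝ v (app (A i) v)) ^ 2) := by
      simp only [mul_pow, ← Finset.mul_sum]
      ring
    have hlow := hF.lower v v
    have hupp := hF.upper v v
    rw [hs v hv] at hlow hupp
    have hpos : 0 < ∑ i, (1 / (n : ℝ) * inner ℝ v (app (A i) v)) ^ 2 := by
      rw [hsq]
      have := hF.lo_pos
      exact mul_pos (by positivity) (by linarith)
    have hV : ς ^ 2 * ∑ i, (1 / (n : ℝ) * inner ℝ v (app (A i) v)) ^ 2 ≤ ς ^ 2 * hi / n := by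
      rw [hsq]
      calc ς ^ 2 * ((1 / (n : ℝ)) * ((1 / (n : ℝ)) * ∑ i, (inner ℝ v (app (A i) v)) ^ 2))
          ≤ ς ^ 2 * ((1 / (n : ℝ)) * hi) := by gcongr; linarith
        _ = ς ^ 2 * hi / n := by ring
    refine (measureReal_abs_sum_mul_ge_le hε _ hpos hV ht0).trans_eq ?_
    congr 2
    rw [htsq]
    field_simp
    ring
  have hpay : (9 : ℝ) ^ p * Real.exp (-(2 * (p * ℓ))) ≤ 1 := by
    have h1 : Real.exp (2 * (p * ℓ)) = ((1 + 2 * (n : ℝ)) ^ 2) ^ p := by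
      rw [← hexp, ← Real.exp_nat_mul, ← Real.exp_nat_mul]
      congr 1
      push_cast
      ring
    have h2 : (9 : ℝ) ^ p ≤ Real.exp (2 * (p * ℓ)) := by
      rw [h1]
      refine pow_le_pow_left₀ (by norm_num) ?_ p
      nlinarith
    rw [Real.exp_neg]
    exact mul_inv_le_one_of_le₀ h2 (Real.exp_pos _).le
  calc μ.real {ω | 2 * t < specNorm (weightedMean A fun i => ε i ω)}
      ≤ μ.real (⋃ v ∈ s, {ω | t ≤ |X v ω|}) := measureReal_mono hsub (measure_ne_top _ _)
    _ ≤ ∑ v ∈ s, μ.real {ω | t ≤ |X v ω|} := measureReal_biUnion_finset_le _ _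
    _ ≤ ∑ v ∈ s, 2 * Real.exp (-(3 * (p * ℓ))) := Finset.sum_le_sum hone
    _ = s.card * (2 * Real.exp (-(3 * (p * ℓ)))) := by rw [Finset.sum_const, nsmul_eq_mul]
    _ ≤ 9 ^ p * (2 * Real.exp (-(3 * (p * ℓ)))) := by gcongr
    _ = 2 * Real.exp (-(p * ℓ)) * (9 ^ p * Real.exp (-(2 * (p * ℓ)))) := by
        have : -(3 * (p * ℓ)) = -(p * ℓ) + -(2 * (p * ℓ)) := by ring
        rw [this, Real.exp_add]; ring
    _ ≤ 2 * Real.exp (-(p * ℓ)) * 1 := by gcongr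
    _ = prob₁ n p := by rw [mul_one, prob₁]

end Noise

/-! ### Sample size and conclusion -/

/-- The sample size condition makes the noise level small enough for global minimality. -/
theorem noise_level_le_of_sample_size {n p : ℕ} {lo hi ς r : ℝ} (hlo : 0 < lo) (hhi : 0 < hi)
    (hr : 0 < r) (hn : 0 < n) (hp : 0 < p)
    (hsize : 96 * (4 * lo + 3 * hi) ^ 2 * hi * ς ^ 2 / (lo ^ 4 * r ^ 4) ≤
      (n : ℝ) / ((p : ℝ) * Real.log (1 + 2 * (n : ℝ)))) :
    4 * (lo + hi) *
        (2 * Real.sqrt (6 * ς ^ 2 * hi * (p : ℝ) * Real.log (1 + 2 * (n : ℝ)) / (n : ℝ))) ≤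
      lo ^ 2 * r ^ 2 := by
  have hn0 : (0 : ℝ) < n := Nat.cast_pos.2 hn
  have hp0 : (0 : ℝ) < p := Nat.cast_pos.2 hp
  have hℓ : 0 < Real.log (1 + 2 * (n : ℝ)) := Real.log_pos (by linarith)
  set ℓ := Real.log (1 + 2 * (n : ℝ))
  set t := Real.sqrt (6 * ς ^ 2 * hi * (p : ℝ) * ℓ / (n : ℝ))
  have ht0 : 0 ≤ t := Real.sqrt_nonneg _
  have htsq : t ^ 2 = 6 * ς ^ 2 * hi * (p : ℝ) * ℓ / (n : ℝ) := Real.sq_sqrt (by positivity)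
  have h1 : (4 * (4 * lo + 3 * hi) * t) ^ 2 ≤ (lo ^ 2 * r ^ 2) ^ 2 := by
    rw [div_le_div_iff₀ (by positivity) (by positivity)] at hsize
    rw [mul_pow, htsq, ← mul_div_assoc, div_le_iff₀ hn0]
    linarith
  have h2 : 4 * (4 * lo + 3 * hi) * t ≤ lo ^ 2 * r ^ 2 :=
    le_of_sq_le_sq h1 (by positivity)
  nlinarith [mul_nonneg hlo.le ht0, mul_nonneg hhi.le ht0]

end QMR

theorem mainTheorem8
    {Ω : Type*} [MeasurableSpace Ω] (μ : Measure Ω) [IsProbabilityMeasure μ]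
    (n p : ℕ) [NeZero n]
    (A : Fin n → Matrix (Fin p) (Fin p) ℝ) (hAsymm : ∀ i, (A i).IsSymm)
    (xs : QMR.Vec p) (hxs : xs ≠ 0)
    (lo hi : ℝ) (hA : QMR.FrameBounds A lo hi) (hlohi : hi < 3 * lo)
    (ε : Fin n → Ω → ℝ) (ς : ℝ) (hε : QMR.SubGaussianNoise μ ε ς)
    (hn : max
        (98 * (4 * lo + 3 * hi) ^ 4 * hi * ς ^ 2 / (lo * (3 * lo - hi) ^ 2 * ‖xs‖ ^ 4))
        (96 * (4 * lo + 3 * hi) ^ 2 * hi * ς ^ 2 / (lo ^ 4 * ‖xs‖ ^ 4))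
      ≤ (n : ℝ) / ((p : ℝ) * Real.log (1 + 2 * (n : ℝ))))
    (P : QMR.Params) (x₀ : Ω → QMR.Vec p) :
    ∃ E : Set Ω, MeasurableSet E ∧
      1 - 2 * QMR.prob₁ n p - QMR.prob₂ n (∫ ω, (ε 0 ω) ^ 2 ∂μ) ς ≤ μ.real E ∧
      ∀ ω ∈ E,
        let b : Fin n → ℝ := QMR.observations A xs (fun i => ε i ω)
        let x : ℕ → QMR.Vec p := QMR.grnm A b P (x₀ ω)
        ∀ xbar : QMR.Vec p, xbar ≠ 0 → MapClusterPt xbar atTop x →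
          QMR.specNorm ((1 / (n : ℝ)) • ∑ i, QMR.residual A b i xbar • A i)
            < 2 * lo * ‖xbar‖ ^ 2 →
          Tendsto x atTop (𝓝 xbar) ∧
          (∀ y : QMR.Vec p, QMR.objective A b xbar ≤ QMR.objective A b y) ∧
          min ‖xbar - xs‖ ‖xbar + xs‖ ≤
            4 / (lo * ‖xs‖) *
              Real.sqrt (6 * ς ^ 2 * hi * (p : ℝ) * Real.log (1 + 2 * (n : ℝ)) / (n : ℝ)) := by
  have hlo := hA.lo_pos
  have hr : 0 < ‖xs‖ := norm_pos_iff.2 hxs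
  have hp : 0 < p := by
    rcases Nat.eq_zero_or_pos p with rfl | h
    · exact absurd (Subsingleton.elim xs 0) hxs
    · exact h
  have hlevel := QMR.noise_level_le_of_sample_size hlo hA.hi_pos hr (NeZero.pos n) hp
    ((le_max_right _ _).trans hn)
  have hbad := QMR.measureReal_specNorm_noise_gt_le (p := p) hAsymm hA hε
  set t := Real.sqrt (6 * ς ^ 2 * hi * (p : ℝ) * Real.log (1 + 2 * (n : ℝ)) / (n : ℝ))
  set B := {ω | 2 * t < QMR.specNorm (QMR.weightedMean A fun i => ε i ω)}
  -- The noise need not be measurable, only almost everywhere measurable, so the event is the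
  -- complement of a measurable hull of the set where the noise is large.
  refine ⟨(toMeasurable μ B)ᶜ, (measurableSet_toMeasurable μ B).compl, ?_, ?_⟩
  · have h1 : 0 ≤ QMR.prob₁ n p := mul_nonneg zero_le_two (Real.exp_pos _).le
    have h2 : 0 ≤ QMR.prob₂ n (∫ ω, (ε 0 ω) ^ 2 ∂μ) ς :=
      mul_nonneg zero_le_two (Real.exp_pos _).le
    have h3 : μ.real (toMeasurable μ B) = μ.real B := by
      rw [measureReal_def, measure_toMeasurable, measureReal_def]
    rw [probReal_compl_eq_one_sub (measurableSet_toMeasurable μ B), h3]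
    linarith
  · intro ω hω b x xbar hxbar hcl hS
    have hN : QMR.specNorm (QMR.weightedMean A fun i => ε i ω) ≤ 2 * t :=
      not_lt.1 fun h => hω (subset_toMeasurable μ B h)
    have hstat : QMR.app (QMR.residualMean A b xbar) xbar = 0 := by
      rw [← QMR.gradient_objective b hAsymm hA]
      exact QMR.gradient_eq_zero_of_mapClusterPt_grnm b P hAsymm hA hxbar hcl
    refine ⟨QMR.tendsto_grnm b P hAsymm hA hxbar hcl hS,
      QMR.objective_le_of_stationary_of_noise_le hAsymm hA hxbar hstat hS ?_, ?_⟩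
    · refine le_trans ?_ hlevel
      have := hA.hi_pos
      gcongr
    · have h1 := QMR.mul_norm_sub_mul_norm_add_le hAsymm hA hxbar hstat hS
      have h2 := mul_le_mul_of_nonneg_left (QMR.min_norm_mul_norm_le xbar xs) hlo.le
      rw [div_mul_eq_mul_div, le_div_iff₀ (mul_pos hlo hr)]
      linarith
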